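/- **Theorem.** There is a universal constant $c$ such that the following holds. Let $A\ge 1$ be real, let $B,K\ge 1$ be integers, and let $T$ be a deterministic Turing machine with $B$ states and $B$ tape symbols that has one two-way infinite tape whose cells are empty or hold a symbol, writes a symbol and moves one cell left or right in every step, gives a yes/no result determined by its halting state and the scanned cell, and halts within $K n^A$ steps on every input of length $n\ge 1$ (so $T\in\mathrm{TIME}(n^A)$). Then there are linear RNNs $(R_n)_{n\ge 1}$ and an $n_0$ such that for every $n\ge 1$: 1. for every input $x_1\cdots x_n$ over the $B$ symbols, $R_n$, started on the token sequence $\texttt{<s>},x_1,\dots,x_n$ and using chain of thought (CoT) with in-context retrieval, outputs the result of $T$ on $x_1\cdots x_n$ ($\mathrm{YES}$ or $\mathrm{NO}$) after at most $cKn^A=O(n^A)$ steps; 2. if $n\ge n_0$, then $R_n$ has precision at most $cA\log_2 n$ bits and recurrent state memory at most $cA\log_2 n$ bits; 3. $R_n$ has at most $cAB^2$ parameters, all of the precision of $R_n$; 4. the vocabulary of $R_n$ consists of $B$ special symbols (the tape symbols), a fixed finite set of further special tokens (the control tokens $\texttt{<s>},\sim,\mathrm{YES},\mathrm{NO},\texttt{<StartSearch>},\texttt{<EndSearch>},\mathrm{FAILED}$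 and the characters used in writing regular expressions), and the numbers $1,\dots,N$ with $N\le cKn^A$. *Linear RNN.* The $\ell$-th token of the sequence is embedded in $\mathbb R^d$ as its word embedding plus $\ell w_d$; the word embedding of the number $k$ is $k w_1+k^2w_2$, and each special token has its own coordinate vector $w_j$, $2<j<d$. The network is a composition of blocks $f(X)=X+\mathrm{LU}(X)+g(X+\mathrm{LU}(X))$ with $\mathrm{LU}(X)_{:,t}=h_t$, $h_0=0$, $h_t=\mathbf A h_{t-1}+\mathbf B X_{:,t}$, and $g(x)=W_3\big(\mathrm{ReLU}(W_1x+b_1)\otimes(W_2x+b_2)\big)+b_3$. The next-token distribution is the softmax of the word embedding matrix times the last column of the output; the next token is its unique maximizer. The arithmetic is that of numbers $\pm j2^{-q}$, $0\le j<2^{2q}$, of precision $2q+1$ bits; each affine map, entrywise product and vector sum, and each logit, is computed exactly and then rounded to the nearest such number (the softmax is exact). Parameters are all entries, zero or not, of all matrices and bias vectors. The memory is the precision times the number of coordinates of the states $h$, over all blocks, whose rows in $\mathbf A$ and $\mathbf B$ are not both zero (the other coordinates are constantly zero). *CoT with in-context retrieval.* In every step the next token is appended to the sequence; the process stops with that token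 as output, without counting a further step, when it is $\mathrm{YES}$ or $\mathrm{NO}$. When it is $\texttt{<EndSearch>}$, the result of the following query is appended as well. The tokens after the last $\texttt{<StartSearch>}$, written as a string, are read as a regular expression in the syntax of Python's `re` library; the result is the first capturing group of its first match (`re.search(pattern, string).group(1)`), tokenized, in the string of all tokens before that $\texttt{<StartSearch>}$, and $\mathrm{FAILED}$ if there is no match. In writing tokens as a string, numbers are in decimal, each tape symbol is one character, adjacent words (numbers, tape symbols, control tokens) are separated by a blank, and regular-expression characters are attached to their neighbours without a blank. -/

import Mathlib

/-! ### Turing machines -/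

namespace RagRNN

/-- A one-tape Turing machine with `B` states and `B` tape symbols. The tape is two-way infinite
and a cell is either empty (`none`) or holds one of the `B` symbols. In a non-halting state the
machine reads the scanned cell, changes state, writes a symbol and moves one cell to the right
(`true`) or to the left (`false`). The verdict of a halted machine is read off its halting state
and the scanned cell; this covers machines with accepting and rejecting states as well as machines
with one halting state that leave their answer under the head. -/
structure TM (B : ℕ) where
  start : Fin B
  halting : Fin B → Bool
  trans : Fin B → Option (Fin B) → Fin B × Fin B × Bool
  verdict : Fin B → Option (Fin B) → Bool

/-- Configurations of a machine. -/
structure Cfg (B : ℕ) where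
  state : Fin B
  head : ℤ
  tape : ℤ → Option (Fin B)

namespace TM

variable {B : ℕ}

/-- The input is written on the cells `1, …, n`, all other cells are empty, the head is on cell
`1`. -/
def init (M : TM B) (x : List (Fin B)) : Cfg B where
  state := M.start
  head := 1
  tape := fun i => if 1 ≤ i then x[(i - 1).toNat]? else none

/-- One step; a halted configuration stays as it is. -/
def step (M : TM B) (c : Cfg B) : Cfg B :=
  if M.halting c.state = true then c
  else
    let r := M.trans c.state (c.tape c.head)
    { state := r.1
      head := if r.2.2 = true then c.head + 1 else c.head - 1
      tape := Function.update c.tape c.head (some r.2.1) }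

/-- The configuration after `t` steps on input `x`. -/
def run (M : TM B) (x : List (Fin B)) (t : ℕ) : Cfg B := (M.step)^[t] (M.init x)

/-- `M` has halted after (at most) `t` steps on input `x`. -/
def HaltedAt (M : TM B) (x : List (Fin B)) (t : ℕ) : Prop :=
  M.halting (M.run x t).state = true

/-- `M` halts on input `x` with the yes/no result `b`. -/
def Result (M : TM B) (x : List (Fin B)) (b : Bool) : Prop :=
  ∃ t, M.HaltedAt x t ∧ M.verdict (M.run x t).state ((M.run x t).tape (M.run x t).head) = b

/-- `M` halts on every nonempty input, of length `n` say, within `K * n ^ A` steps. -/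
def RunsInTime (M : TM B) (A : ℝ) (K : ℕ) : Prop :=
  ∀ x : List (Fin B), x ≠ [] →
    ∃ t : ℕ, (t : ℝ) ≤ (K : ℝ) * (x.length : ℝ) ^ A ∧ M.HaltedAt x t

end TM

/-! ### Characters and tokens -/

/-- The characters in which regular expressions are written, other than literals:
blank `^ $ . * + ? ( ) | { } \ :` and the letters `S s b` (of `\S \s \b`). -/
inductive RxChar
  | space | caret | dollar | dot | star | plus | quest | lpar | rpar | bar
  | lbrace | rbrace | bslash | colon | bigS | smallS | smallB
  deriving DecidableEq

instance : Fintype RxChar :=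
  ⟨{.space, .caret, .dollar, .dot, .star, .plus, .quest, .lpar, .rpar, .bar,
    .lbrace, .rbrace, .bslash, .colon, .bigS, .smallS, .smallB},
    by intro x; cases x <;> decide⟩

/-- The remaining letters that occur in the names of the control tokens. -/
inductive Letter
  | bigA | bigD | bigE | bigF | bigI | bigL | bigN | bigO | bigY
  | a | c | d | e | h | n | r | t
  deriving DecidableEq

/-- The characters of strings: every tape symbol is one character of its own. -/
inductive Chr (B : ℕ)
  | rx (c : RxChar)
  | letter (l : Letter)
  | digit (k : Fin 10)
  | sym (i : Fin B)
  | lt | gt | tilde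
  deriving DecidableEq

/-- Control tokens: `<s>`, `~`, `YES`, `NO`, `<StartSearch>`, `<EndSearch>`, `FAILED`. -/
inductive Ctl
  | bos | edge | yes | no | startSearch | endSearch | failed
  deriving DecidableEq

instance : Fintype Ctl :=
  ⟨{.bos, .edge, .yes, .no, .startSearch, .endSearch, .failed},
    by intro x; cases x <;> decide⟩

/-- Special tokens: the `B` tape symbols, and a fixed finite set of control tokens and
regular-expression characters. -/
inductive Special (B : ℕ)
  | sym (i : Fin B)
  | ctl (c : Ctl)
  | rx (c : RxChar)
  deriving DecidableEq, Fintype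

/-- The vocabulary: the numbers `1, …, N` (`num i` is the number `i + 1`) and the special
tokens. -/
inductive Tok (B N : ℕ)
  | num (i : Fin N)
  | spec (s : Special B)
  deriving DecidableEq, Fintype

/-- The name of a control token. -/
def Ctl.chars {B : ℕ} : Ctl → List (Chr B)
  | .bos => [.lt, .rx .smallS, .gt]
  | .edge => [.tilde]
  | .yes => [.letter .bigY, .letter .bigE, .rx .bigS]
  | .no => [.letter .bigN, .letter .bigO]
  | .startSearch =>
    [.lt, .rx .bigS, .letter .t, .letter .a, .letter .r, .letter .t,
      .rx .bigS, .letter .e, .letter .a, .letter .r, .letter .c, .letter .h, .gt]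
  | .endSearch =>
    [.lt, .letter .bigE, .letter .n, .letter .d,
      .rx .bigS, .letter .e, .letter .a, .letter .r, .letter .c, .letter .h, .gt]
  | .failed =>
    [.letter .bigF, .letter .bigA, .letter .bigI, .letter .bigL, .letter .bigE, .letter .bigD]

/-- The decimal notation of a natural number. -/
def decimal {B : ℕ} (k : ℕ) : List (Chr B) :=
  (Nat.digits 10 k).reverse.map fun d => .digit ⟨d % 10, Nat.mod_lt d (by norm_num)⟩

namespace Tok

variable {B N : ℕ}

def chars : Tok B N → List (Chr B)
  | num i => decimal (i.val + 1)
  | spec (.sym i) => [.sym i]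
  | spec (.ctl c) => c.chars
  | spec (.rx c) => [.rx c]

/-- Numbers, tape symbols and control tokens are words; regular-expression characters are not. -/
def isWord : Tok B N → Bool
  | spec (.rx _) => false
  | _ => true

/-- Detokenization: adjacent words are separated by one blank; a regular-expression character is
attached to its neighbours without a blank, so that it can act on them. -/
def detokenize : List (Tok B N) → List (Chr B)
  | [] => []
  | [s] => s.chars
  | s :: s' :: S =>
    s.chars ++ (if s.isWord && s'.isWord then [.rx .space] else []) ++ detokenize (s' :: S)

open Classical in
/-- Tokenization of a text: the sequence of words that it spells, if it spells one. -/
noncomputable def tokenize (w : List (Chr B)) : Option (List (Tok B N)) :=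
  if h : ∃ S : List (Tok B N), (∀ s ∈ S, s.isWord = true) ∧ detokenize S = w
  then some h.choose else none

end Tok

/-! ### Regular expressions, with the semantics of the `re` library of Python -/

/-- Abstract syntax; `group k` is the `k`-th capturing group, `star true` is greedy and
`star false` is lazy. -/
inductive Regex (B : ℕ)
  | eps
  | chr (c : Chr B)
  | any
  | blank
  | nonblank
  | atStart
  | atEnd
  | boundary
  | seq (r s : Regex B)
  | alt (r s : Regex B)
  | star (greedy : Bool) (r : Regex B)
  | rep (m : ℕ) (r : Regex B)
  | group (k : ℕ) (r : Regex B)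

/-- A state of the backtracking matcher: the text read so far (reversed), the text to come, and
the current value of the first capturing group. -/
structure MState (B : ℕ) where
  past : List (Chr B)
  rest : List (Chr B)
  cap : Option (List (Chr B))

/-- The characters that count as letters or digits for `\b`. -/
def Chr.isAlnum {B : ℕ} : Chr B → Bool
  | letter _ => true
  | digit _ => true
  | sym _ => true
  | rx .bigS => true
  | rx .smallS => true
  | rx .smallB => true
  | _ => false

namespace Regex

variable {B : ℕ}

/-- Read one character that passes the test. -/
def consume (test : Chr B → Bool) (st : MState B) : List (MState B) :=
  match st.rest with
  | [] => []
  | c :: w => if test c = true then [⟨c :: st.past, w, st.cap⟩] else []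

/-- Up to `k` iterations of `f`, with more iterations preferred if `greedy`, and fewer if not. -/
def iter (f : MState B → List (MState B)) (greedy : Bool) : ℕ → MState B → List (MState B)
  | 0, st => [st]
  | k + 1, st =>
    if greedy = true then (f st).flatMap (iter f greedy k) ++ [st]
    else st :: (f st).flatMap (iter f greedy k)

/-- Exactly `m` iterations of `f`. -/
def iterExact (f : MState B → List (MState B)) : ℕ → MState B → List (MState B)
  | 0, st => [st]
  | m + 1, st => (f st).flatMap (iterExact f m)

/-- All ways to match the expression from a state, in the order in which backtracking finds them.
The bodies of stars read at least one character in every expression that the parser accepts, so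
that the number of iterations is at most the length of the remaining text. -/
def matchFrom : Regex B → MState B → List (MState B)
  | eps, st => [st]
  | chr c, st => consume (fun x => decide (x = c)) st
  | any, st => consume (fun _ => true) st
  | blank, st => consume (fun x => decide (x = .rx .space)) st
  | nonblank, st => consume (fun x => decide (x ≠ .rx .space)) st
  | atStart, st => if st.past.isEmpty then [st] else []
  | atEnd, st => if st.rest.isEmpty then [st] else []
  | boundary, st =>
    if (st.past.head?.any Chr.isAlnum) != (st.rest.head?.any Chr.isAlnum) then [st] else []
  | seq r s, st => (matchFrom r st).flatMap (matchFrom s)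
  | alt r s, st => matchFrom r st ++ matchFrom s st
  | star greedy r, st => iter (matchFrom r) greedy st.rest.length st
  | rep m r, st => iterExact (matchFrom r) m st
  | group k r, st =>
    (matchFrom r st).map fun st' =>
      if k = 1 then ⟨st'.past, st'.rest, some (st.rest.take (st.rest.length - st'.rest.length))⟩
      else st'

/-- The first match in the text, the starting point moving from left to right. -/
def search (r : Regex B) (text : List (Chr B)) : Option (MState B) :=
  ((List.range (text.length + 1)).flatMap fun i =>
    matchFrom r ⟨(text.take i).reverse, text.drop i, none⟩).head?

/-- The expression can match the empty text. -/
def nullable : Regex B → Bool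
  | eps => true
  | chr _ => false
  | any => false
  | blank => false
  | nonblank => false
  | atStart => true
  | atEnd => true
  | boundary => true
  | seq r s => nullable r && nullable s
  | alt r s => nullable r || nullable s
  | star _ _ => true
  | rep m r => decide (m = 0) || nullable r
  | group _ r => nullable r

end Regex

/-! ### The concrete syntax of regular expressions

The parser reads the pattern from left to right. It accepts literals, `.`, `\S`, `\s`, `\b`, `^`,
`$`, escaped metacharacters, capturing groups `(…)`, groups `(?:…)`, alternatives `|`, and the
quantifiers `*`, `+`, `?`, `*?`, `+?`, `??`, `{m}`, applied to expressions that do not match the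
empty text. On these patterns the meaning is that of Python; all other patterns are rejected. -/

/-- The last item of the current sequence, which a quantifier may still change: nothing, an
unquantified item, or a quantified item in its greedy and its lazy version. -/
inductive Pending (B : ℕ)
  | nothing
  | item (r : Regex B)
  | quantified (greedy lazy : Regex B)

/-- An open group: its number if it is capturing, the alternatives completed so far, and the
current sequence. -/
structure Frame (B : ℕ) where
  number : Option ℕ
  alts : Option (Regex B)
  acc : Regex B
  pending : Pending B

namespace Frame

variable {B : ℕ}

def opening (number : Option ℕ) : Frame B := ⟨number, none, .eps, .nothing⟩

def flush (f : Frame B) : Regex B :=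
  match f.pending with
  | .nothing => f.acc
  | .item r => .seq f.acc r
  | .quantified g _ => .seq f.acc g

def push (f : Frame B) (r : Regex B) : Frame B := ⟨f.number, f.alts, f.flush, .item r⟩

def body (f : Frame B) : Regex B :=
  match f.alts with
  | none => f.flush
  | some r => .alt r f.flush

def close (f : Frame B) : Regex B :=
  match f.number with
  | none => f.body
  | some k => .group k f.body

def bar (f : Frame B) : Frame B := ⟨f.number, some f.body, .eps, .nothing⟩

/-- Apply a quantifier, given in its greedy and its lazy version. -/
def quantify (f : Frame B) (g l : Regex B → Regex B) : Option (Frame B) :=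
  match f.pending with
  | .item r =>
    if r.nullable = true then none
    else some ⟨f.number, f.alts, f.acc, .quantified (g r) (l r)⟩
  | _ => none

/-- The character `?` is a quantifier, or makes the preceding quantifier lazy. -/
def question (f : Frame B) : Option (Frame B) :=
  match f.pending with
  | .quantified _ l => some ⟨f.number, f.alts, .seq f.acc l, .nothing⟩
  | _ => f.quantify (fun r => .alt r .eps) (fun r => .alt .eps r)

end Frame

/-- The reading mode of the parser: plain, after `\`, after `(`, after `(?`, and inside `{…}` with
the value of the digits read so far. -/
inductive PMode
  | plain
  | escaped
  | opened
  | openedQuest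
  | braces (m : Option ℕ)

/-- A state of the parser: mode, number of capturing groups opened so far, the enclosing open
groups, the innermost open group. -/
structure PState (B : ℕ) where
  mode : PMode
  groups : ℕ
  stack : List (Frame B)
  top : Frame B

namespace PState

variable {B : ℕ}

/-- Continue in plain mode with the given innermost group. -/
def withTop (s : PState B) (f : Frame B) : PState B := ⟨.plain, s.groups, s.stack, f⟩

def plainStep (s : PState B) : Chr B → Option (PState B)
  | .rx .caret => some (s.withTop (s.top.push .atStart))
  | .rx .dollar => some (s.withTop (s.top.push .atEnd))
  | .rx .dot => some (s.withTop (s.top.push .any))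
  | .rx .star => (s.top.quantify (fun r => .star true r) (fun r => .star false r)).map s.withTop
  | .rx .plus =>
    (s.top.quantify (fun r => .seq r (.star true r)) (fun r => .seq r (.star false r))).map
      s.withTop
  | .rx .quest => s.top.question.map s.withTop
  | .rx .lpar => some ⟨.opened, s.groups, s.stack, s.top⟩
  | .rx .rpar =>
    match s.stack with
    | [] => none
    | f :: fs => some ⟨.plain, s.groups, fs, f.push s.top.close⟩
  | .rx .bar => some (s.withTop s.top.bar)
  | .rx .lbrace => some ⟨.braces none, s.groups, s.stack, s.top⟩
  | .rx .rbrace => none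
  | .rx .bslash => some ⟨.escaped, s.groups, s.stack, s.top⟩
  | c => some (s.withTop (s.top.push (.chr c)))

def escapedStep (s : PState B) : Chr B → Option (PState B)
  | .rx .bigS => some (s.withTop (s.top.push .nonblank))
  | .rx .smallS => some (s.withTop (s.top.push .blank))
  | .rx .smallB => some (s.withTop (s.top.push .boundary))
  | .rx .space => none
  | .rx .colon => none
  | .rx c => some (s.withTop (s.top.push (.chr (.rx c))))
  | _ => none

def step (s : PState B) (c : Chr B) : Option (PState B) :=
  match s.mode with
  | .plain => s.plainStep c
  | .escaped => s.escapedStep c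
  | .opened =>
    if c = .rx .quest then some ⟨.openedQuest, s.groups, s.stack, s.top⟩
    else plainStep
      ⟨.plain, s.groups + 1, s.top :: s.stack, Frame.opening (some (s.groups + 1))⟩ c
  | .openedQuest =>
    if c = .rx .colon then some ⟨.plain, s.groups, s.top :: s.stack, Frame.opening none⟩
    else none
  | .braces m =>
    match c with
    | .digit d => some ⟨.braces (some (m.getD 0 * 10 + d.val)), s.groups, s.stack, s.top⟩
    | .rx .rbrace =>
      m.bind fun k =>
        (s.top.quantify (fun r => .rep k r) (fun r => .rep k r)).map s.withTop
    | _ => none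

end PState

/-- Parse a pattern. -/
def Regex.parse {B : ℕ} (pattern : List (Chr B)) : Option (Regex B) :=
  (pattern.foldlM PState.step ⟨.plain, 0, [], Frame.opening none⟩).bind fun s =>
    match s.mode, s.stack with
    | .plain, [] => some s.top.body
    | _, _ => none

/-! ### In-context retrieval -/

/-- Cut a sequence at its last `<StartSearch>`, into what stands before and after it. -/
def splitQuery {B N : ℕ} : List (Tok B N) → Option (List (Tok B N) × List (Tok B N))
  | [] => none
  | s :: S =>
    match splitQuery S with
    | some (U, Q) => some (s :: U, Q)
    | none => if s = .spec (.ctl .startSearch) then some ([], S) else none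

/-- `retrieve S` is the result of the query that is completed by appending `<EndSearch>` to `S`:
the tokens after the last `<StartSearch>` are the pattern, the tokens before it are the text; the
result is the first capturing group of the first match, and `FAILED` if there is no match. It is
undefined (`none`) if there is no query, if the pattern is rejected, if it matches without setting
its first group, or if the group is not a sequence of words of the vocabulary. -/
noncomputable def retrieve {B N : ℕ} (S : List (Tok B N)) : Option (List (Tok B N)) :=
  (splitQuery S).bind fun UQ =>
    (Regex.parse (Tok.detokenize UQ.2)).bind fun r =>
      match r.search (Tok.detokenize UQ.1) with
      | none => some [.spec (.ctl .failed)]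
      | some st => st.cap.bind Tok.tokenize

/-! ### Fixed-precision arithmetic -/

/-- The numbers of precision `p = 2 * q + 1`: one bit for the sign, `q` bits before and `q` bits
after the binary point. -/
def fixedNumbers (q : ℕ) : Set ℝ := {x | ∃ k : ℤ, |k| < 2 ^ (2 * q) ∧ x = (k : ℝ) / 2 ^ q}

/-- Rounding to the nearest number of precision `2 * q + 1`. -/
noncomputable def rnd (q : ℕ) (x : ℝ) : ℝ :=
  ((max (-(2 ^ (2 * q) - 1)) (min (2 ^ (2 * q) - 1) (round (x * 2 ^ q))) : ℤ) : ℝ) / 2 ^ q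

/-- Coordinatewise rounding. -/
noncomputable def rndVec {ι : Type} (q : ℕ) (v : ι → ℝ) : ι → ℝ := fun i => rnd q (v i)

/-! ### Linear RNNs -/

/-- The coordinates of the embedding space: two for numbers, one for every special token, `m`
further ones, and one for the position. -/
inductive Coord (B m : ℕ)
  | num
  | numSq
  | special (s : Special B)
  | work (j : Fin m)
  | pos
  deriving DecidableEq, Fintype

/-- Word embedding: the number `k` has coordinates `k` and `k ^ 2` in the two number coordinates;
a special token is the unit vector of its own coordinate. -/
noncomputable def wordEmb {B N : ℕ} (m : ℕ) : Tok B N → Coord B m → ℝ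
  | .num i, .num => (i.val + 1 : ℝ)
  | .num i, .numSq => (i.val + 1 : ℝ) ^ 2
  | .spec s, .special s' => if s = s' then 1 else 0
  | _, _ => 0

/-- Position embedding: the `l`-th token has `l` in the position coordinate. -/
noncomputable def posEmb {B : ℕ} (m l : ℕ) : Coord B m → ℝ
  | .pos => l
  | _ => 0

/-- The parameters of a block of width `w`: the two matrices of the linear unit, and the weights
and biases of the ReGLU feed-forward network. -/
structure Block (ι : Type) (w : ℕ) where
  luA : Matrix ι ι ℝ
  luB : Matrix ι ι ℝ
  W₁ : Matrix (Fin w) ι ℝ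
  b₁ : Fin w → ℝ
  W₂ : Matrix (Fin w) ι ℝ
  b₂ : Fin w → ℝ
  W₃ : Matrix ι (Fin w) ℝ
  b₃ : ι → ℝ

namespace Block

variable {ι : Type} [Fintype ι] {w : ℕ}

/-- The state of the linear unit: `h 0 = 0`, and `h (t + 1) = A h t + B x`, where `x` is the
`(t + 1)`-th column `X t` of the input. -/
noncomputable def hidden (F : Block ι w) (q : ℕ) (X : ℕ → ι → ℝ) : ℕ → ι → ℝ
  | 0 => 0
  | t + 1 => rndVec q (F.luA.mulVec (hidden F q X t) + F.luB.mulVec (X t))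

/-- The feed-forward network `W₃ (ReLU (W₁ x + b₁) ⊗ (W₂ x + b₂)) + b₃`. -/
noncomputable def ffn (F : Block ι w) (q : ℕ) (x : ι → ℝ) : ι → ℝ :=
  let u := rndVec q (F.W₁.mulVec x + F.b₁)
  let v := rndVec q (F.W₂.mulVec x + F.b₂)
  rndVec q (F.W₃.mulVec (rndVec q fun j => max (u j) 0 * v j) + F.b₃)

/-- The block `X + LU X + g (X + LU X)`, as a map of sequences of columns. -/
noncomputable def apply (F : Block ι w) (q : ℕ) (X : ℕ → ι → ℝ) : ℕ → ι → ℝ := fun t =>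
  let y := rndVec q (X t + F.hidden q X (t + 1))
  rndVec q (y + F.ffn q y)

/-- All parameters are numbers of precision `2 * q + 1`. -/
def InPrecision (F : Block ι w) (q : ℕ) : Prop :=
  (∀ i j, F.luA i j ∈ fixedNumbers q) ∧ (∀ i j, F.luB i j ∈ fixedNumbers q) ∧
  (∀ i j, F.W₁ i j ∈ fixedNumbers q) ∧ (∀ i, F.b₁ i ∈ fixedNumbers q) ∧
  (∀ i j, F.W₂ i j ∈ fixedNumbers q) ∧ (∀ i, F.b₂ i ∈ fixedNumbers q) ∧
  (∀ i j, F.W₃ i j ∈ fixedNumbers q) ∧ (∀ i, F.b₃ i ∈ fixedNumbers q)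

open Classical in
/-- The number of state coordinates that have to be stored. A coordinate whose rows in both
matrices of the linear unit vanish is constantly zero. -/
noncomputable def stateDim (F : Block ι w) : ℕ :=
  (Finset.univ.filter fun i : ι => (∃ j, F.luA i j ≠ 0) ∨ (∃ j, F.luB i j ≠ 0)).card

end Block

/-- A linear RNN whose vocabulary consists of `N` numbers and the special tokens over `B` symbols.
Its precision is `2 * half + 1` bits, `extra` is the number of further coordinates of the embedding
space, `width` is the width of its feed-forward networks. -/
structure LinearRNN (B : ℕ) where
  N : ℕ
  half : ℕ
  extra : ℕ
  width : ℕ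
  layers : List (Block (Coord B extra) width)

namespace LinearRNN

variable {B : ℕ} (R : LinearRNN B)

/-- The number of bits of precision. -/
def precision : ℕ := 2 * R.half + 1

/-- The number of bits of the recurrent state. -/
noncomputable def memory : ℕ := (R.layers.map Block.stateDim).sum * R.precision

/-- The dimension of the embedding space. -/
def dim : ℕ := Fintype.card (Coord B R.extra)

/-- The number of entries, zero or not, of all weight matrices and bias vectors. -/
def numParams : ℕ :=
  R.layers.length * (2 * R.dim ^ 2 + 3 * (R.width * R.dim) + 2 * R.width + R.dim)

/-- All parameters are numbers of the precision of the network. -/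
def InPrecision : Prop := ∀ F ∈ R.layers, F.InPrecision R.half

/-- The embedded sequence; columns beyond the end of `S` are never used. -/
noncomputable def embed (S : List (Tok B R.N)) : ℕ → Coord B R.extra → ℝ := fun t =>
  match S[t]? with
  | some s => rndVec R.half (wordEmb R.extra s + posEmb R.extra (t + 1))
  | none => 0

/-- The output of the last block at the last token of `S`. -/
noncomputable def output (S : List (Tok B R.N)) : Coord B R.extra → ℝ :=
  (R.layers.foldl (fun X F => F.apply R.half X) (R.embed S)) (S.length - 1)

/-- The product of the word embedding matrix with the output. -/
noncomputable def logit (S : List (Tok B R.N)) (s : Tok B R.N) : ℝ :=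
  rnd R.half (∑ i, rnd R.half (wordEmb R.extra s i) * R.output S i)

/-- The distribution of the next token, by softmax. -/
noncomputable def prob (S : List (Tok B R.N)) (s : Tok B R.N) : ℝ :=
  Real.exp (R.logit S s) / ∑ s', Real.exp (R.logit S s')

/-- `s` is the next token: it is strictly more probable than every other token. -/
def Next (S : List (Tok B R.N)) (s : Tok B R.N) : Prop :=
  ∀ s', s' ≠ s → R.prob S s' < R.prob S s

/-- The sequence after the token `s` has been generated: it is appended, and if it is
`<EndSearch>`, then the result of the query is appended as well. -/
noncomputable def extend {N : ℕ} (S : List (Tok B N)) (s : Tok B N) : Option (List (Tok B N)) :=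
  if s = .spec (.ctl .endSearch) then (retrieve S).map fun Q => S ++ [s] ++ Q
  else some (S ++ [s])

/-- The answer tokens `YES` (`true`) and `NO` (`false`). -/
def answer {N : ℕ} (b : Bool) : Tok B N := .spec (.ctl (if b = true then .yes else .no))

/-- `R.Solves S b k`: started from the sequence `S`, chain of thought with in-context retrieval
terminates after `k` steps and outputs the answer `b`. -/
inductive Solves : List (Tok B R.N) → Bool → ℕ → Prop
  | done {S : List (Tok B R.N)} {b : Bool} (h : R.Next S (answer b)) : Solves S b 0
  | step {S S' : List (Tok B R.N)} {s : Tok B R.N} {b : Bool} {k : ℕ}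
      (h : R.Next S s) (hyes : s ≠ answer true) (hno : s ≠ answer false)
      (hS : extend S s = some S') (hrest : Solves S' b k) : Solves S b (k + 1)

end LinearRNN

/-- The input sequence `<s>, x₁, …, xₙ`. -/
def inputSeq {B N : ℕ} (x : List (Fin B)) : List (Tok B N) :=
  .spec (.ctl .bos) :: x.map fun i => .spec (.sym i)

end RagRNN

/-!
The chain of thought is a protocol of the computation of the machine. For every step it contains
a query for the scanned cell, the result of the query, and a record `~ k a` saying that the symbol
`a` is written to the cell with label `k`, followed by the direction of the move and the new state.
Labels are positive numbers: the cells `1, 2, …` have the labels `1, 2, …`, and the cells to the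
left of the input have labels beyond all those that can be reached on the right. The query for the
cell with label `k` is `^(?:.*~ k\s|..(?:\S\s){k})(\S)`. The greedy `.*` makes its first alternative
find the last record for the cell; if there is none, the second alternative counts to the `k`-th
input symbol; if there is no such symbol either, the search fails and the cell is empty
(`retrieve_history`). Earlier queries contain `~ k\s`, but no blank after the number, so that they
are not mistaken for records; and the token after the input is not separated from it by a blank, so
that the counting cannot run past the end of the input.

All weights are integers, and all numbers that occur are integers bounded by a power of
`Z = (B + 200) ^ 2 * (T + 2)`, where `T` bounds the running time. The arithmetic with
`q = O(log Z)` bits on each side of the binary point is therefore exact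
(`IntBlock.apply_toBlock_of_reverse`). The network has three blocks.

* The first one remembers the tape symbols among the last 33 tokens in delay lines, and it keeps
  the head position as the sum of all moves so far. Its feed-forward network computes the label of the scanned cell, the
  one-hot form of the state that was read 32 tokens ago, and whether the input has just ended.
* The second one has no memory. It evaluates the transition table: the state is one-hot in the
  features and the scanned symbol is one-hot in the word embedding, so an arbitrary function of both
  is a sum of `B` products `ReLU (u) * v` of affine functions, one neuron each.
* The linear unit of the third one is a queue of 36 tokens. The result of a query puts the tokens of
  the next record and of the next query into it, and the end of the input puts the initial state and
  the first query into it. The logits of the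
  token at the head of the queue are parabolas `2 a j - j ^ 2` in the code `j` of a token, with their
  maximum at `j = a`; the embedding of the number `k` by `k` and `k ^ 2` makes this a linear
  function of the word embedding, also for numbers. The code 0 in the queue stands for the
  label of the scanned cell.

So the recurrent state has a bounded number of coordinates, independent of `B`, while the tape is in
the context. An induction over the steps of the machine (`Simulates.step`, `solves_inputSeq`) gives
36 generated tokens for every step, and `memory_network_le`, `numParams_network_le` and `bits_le`
give the size of the network.
-/

namespace RagRNN

/-! ### Exact arithmetic with integers -/

/-- Integers below `2 ^ q` are among the numbers of the arithmetic, so rounding fixes them. -/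
theorem rnd_intCast {q : ℕ} {k : ℤ} (h : |k| < 2 ^ q) : rnd q (k : ℝ) = k := by
  have hq : (0 : ℤ) < 2 ^ q := by positivity
  have hround : round ((k : ℝ) * 2 ^ q) = k * 2 ^ q := by
    have : ((k : ℝ) * 2 ^ q) = ((k * 2 ^ q : ℤ) : ℝ) := by push_cast; rfl
    rw [this, round_intCast]
  obtain ⟨h1, h2⟩ := abs_lt.1 h
  have hpow : (2 : ℤ) ^ (2 * q) = 2 ^ q * 2 ^ q := by rw [two_mul, pow_add]
  have hmin : min ((2 : ℤ) ^ (2 * q) - 1) (k * 2 ^ q) = k * 2 ^ q := by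
    apply min_eq_right; rw [hpow]; nlinarith
  have hmax : max (-((2 : ℤ) ^ (2 * q) - 1)) (k * 2 ^ q) = k * 2 ^ q := by
    apply max_eq_right; rw [hpow]; nlinarith
  rw [rnd, hround, hmin, hmax]
  push_cast
  field_simp

theorem intCast_mem_fixedNumbers {q : ℕ} {k : ℤ} (h : |k| < 2 ^ q) :
    (k : ℝ) ∈ fixedNumbers q := by
  refine ⟨k * 2 ^ q, ?_, by push_cast; field_simp⟩
  have hq : (0 : ℤ) < 2 ^ q := by positivity
  rw [abs_mul, abs_of_pos hq, two_mul, pow_add]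
  exact mul_lt_mul_of_pos_right h hq

/-- One neuron of a ReGLU network with integer weights. It contributes
`ReLU (w₁ x + b₁) * (w₂ x + b₂)` times the vector `out`. -/
structure Gate (ι : Type) where
  w₁ : ι → ℤ
  b₁ : ℤ
  w₂ : ι → ℤ
  b₂ : ℤ
  out : ι → ℤ

/-- The neuron that does nothing. -/
def Gate.idle {ι : Type} : Gate ι := ⟨0, 0, 0, 0, 0⟩

/-- A block with integer weights, its feed-forward network being given by the list of its
neurons. -/
structure IntBlock (ι : Type) where
  luA : ι → ι → ℤ
  luB : ι → ι → ℤ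
  gates : List (Gate ι)
  bias : ι → ℤ

variable {ι : Type}

/-- The value of a neuron, to be weighted with its output vector. -/
def Gate.value [Fintype ι] (g : Gate ι) (y : ι → ℤ) : ℤ :=
  max (g.w₁ ⬝ᵥ y + g.b₁) 0 * (g.w₂ ⬝ᵥ y + g.b₂)

namespace IntBlock

/-- The block of width `w`, padded with idle neurons. -/
noncomputable def toBlock (F : IntBlock ι) (w : ℕ) : Block ι w where
  luA := .of fun i j => (F.luA i j : ℝ)
  luB := .of fun i j => (F.luB i j : ℝ)
  W₁ := .of fun k j => ((F.gates.getD k .idle).w₁ j : ℝ)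
  b₁ := fun k => ((F.gates.getD k .idle).b₁ : ℝ)
  W₂ := .of fun k j => ((F.gates.getD k .idle).w₂ j : ℝ)
  b₂ := fun k => ((F.gates.getD k .idle).b₂ : ℝ)
  W₃ := .of fun i k => ((F.gates.getD k .idle).out i : ℝ)
  b₃ := fun i => (F.bias i : ℝ)

/-- The feed-forward network without rounding. -/
def ffn [Fintype ι] (F : IntBlock ι) (y : ι → ℤ) (i : ι) : ℤ :=
  (F.gates.map fun g => g.out i * g.value y).sum + F.bias i

/-- All weights are at most `Z` in absolute value. -/
structure WeightsLE (F : IntBlock ι) (Z : ℤ) : Prop where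
  luA : ∀ i j, |F.luA i j| ≤ Z
  luB : ∀ i j, |F.luB i j| ≤ Z
  gates : ∀ g ∈ F.gates, (∀ i, |g.w₁ i| ≤ Z) ∧ |g.b₁| ≤ Z ∧ (∀ i, |g.w₂ i| ≤ Z) ∧ |g.b₂| ≤ Z ∧
    ∀ i, |g.out i| ≤ Z
  bias : ∀ i, |F.bias i| ≤ Z

theorem WeightsLE.getD {F : IntBlock ι} {Z : ℤ} (h : F.WeightsLE Z) (hZ : 0 ≤ Z) (k : ℕ) :
    (∀ i, |(F.gates.getD k .idle).w₁ i| ≤ Z) ∧ |(F.gates.getD k .idle).b₁| ≤ Z ∧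
    (∀ i, |(F.gates.getD k .idle).w₂ i| ≤ Z) ∧ |(F.gates.getD k .idle).b₂| ≤ Z ∧
    ∀ i, |(F.gates.getD k .idle).out i| ≤ Z := by
  by_cases hk : k < F.gates.length
  · rw [List.getD_eq_getElem _ _ hk]
    exact h.gates _ (List.getElem_mem hk)
  · rw [List.getD_eq_default _ _ (by omega)]
    simp [Gate.idle, hZ]

theorem WeightsLE.inPrecision {F : IntBlock ι} {Z : ℤ} (h : F.WeightsLE Z) (hZ : 0 ≤ Z) {q : ℕ}
    (hq : Z < 2 ^ q) (w : ℕ) : (F.toBlock w).InPrecision q := by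
  have key : ∀ {k : ℤ}, |k| ≤ Z → (k : ℝ) ∈ fixedNumbers q := fun hk =>
    intCast_mem_fixedNumbers (lt_of_le_of_lt hk hq)
  exact ⟨fun i j => key (h.luA i j), fun i j => key (h.luB i j),
    fun i j => key ((h.getD hZ i).1 j), fun i => key (h.getD hZ i).2.1,
    fun i j => key ((h.getD hZ i).2.2.1 j), fun i => key (h.getD hZ i).2.2.2.1,
    fun i j => key ((h.getD hZ j).2.2.2.2 i), fun i => key (h.bias i)⟩

end IntBlock

theorem sum_fin_getD {α M : Type*} [AddCommMonoid M] (L : List α) (d : α) (f : α → M)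
    (hd : f d = 0) {w : ℕ} (hw : L.length ≤ w) :
    ∑ k : Fin w, f (L.getD k d) = (L.map f).sum := by
  rw [Fin.sum_univ_eq_sum_range (fun k => f (L.getD k d))]
  induction L generalizing w with
  | nil => simp [hd]
  | cons a L ih =>
    obtain ⟨w, rfl⟩ : ∃ v, w = v + 1 := ⟨w - 1, by simp at hw; omega⟩
    rw [Finset.sum_range_succ']
    simp only [List.getD_cons_succ, List.getD_cons_zero, List.map_cons, List.sum_cons]
    rw [ih (by simpa using hw), add_comm]

theorem abs_dotProduct_le [Fintype ι] {a y : ι → ℤ} {Z Y : ℤ} (hZ : 0 ≤ Z)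
    (ha : ∀ i, |a i| ≤ Z) (hy : ∀ i, |y i| ≤ Y) : |a ⬝ᵥ y| ≤ Fintype.card ι * (Z * Y) := by
  calc |a ⬝ᵥ y| ≤ ∑ i, |a i * y i| := Finset.abs_sum_le_sum_abs _ _
    _ ≤ ∑ _i : ι, Z * Y := by
      refine Finset.sum_le_sum fun i _ => ?_
      rw [abs_mul]
      exact mul_le_mul (ha i) (hy i) (abs_nonneg _) hZ
    _ = _ := by simp

theorem abs_list_sum_le {α : Type*} (L : List α) (f : α → ℤ) {Y : ℤ}
    (h : ∀ a ∈ L, |f a| ≤ Y) : |(L.map f).sum| ≤ L.length * Y := by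
  induction L with
  | nil => simp
  | cons a L ih =>
    have h1 := h a (by simp)
    have h2 := ih fun b hb => h b (by simp [hb])
    simp only [List.map_cons, List.sum_cons, List.length_cons]
    push_cast
    calc |f a + (L.map f).sum| ≤ |f a| + |(L.map f).sum| := abs_add_le _ _
      _ ≤ _ := by linarith

theorem cast_dotProduct [Fintype ι] (a y : ι → ℤ) :
    (∑ i, (a i : ℝ) * (y i : ℝ)) = ((a ⬝ᵥ y : ℤ) : ℝ) := by
  simp [dotProduct]

namespace IntBlock

variable [Fintype ι] {F : IntBlock ι} {Z : ℤ}

/-- If the integer recursion `H` of the linear unit stays below `2 ^ q`, it is its exact state. -/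
theorem hidden_toBlock {q w t : ℕ} {Xr : ℕ → ι → ℝ} {X H : ℕ → ι → ℤ}
    (hX : ∀ s ≤ t, ∀ i, Xr s i = X s i) (h0 : H 0 = 0)
    (hH : ∀ s ≤ t, ∀ i, H (s + 1) i = F.luA i ⬝ᵥ H s + F.luB i ⬝ᵥ X s)
    (hb : ∀ s ≤ t, ∀ i, |H (s + 1) i| < 2 ^ q) :
    ∀ s ≤ t + 1, ∀ i, (F.toBlock w).hidden q Xr s i = H s i := by
  intro s
  induction s with
  | zero => intro _ i; simp [Block.hidden, h0]
  | succ s ih =>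
    intro hs i
    have hs' : s ≤ t := by omega
    rw [Block.hidden, rndVec, ← rnd_intCast (hb s hs' i), hH s hs' i]
    congr 1
    rw [Int.cast_add, ← cast_dotProduct, ← cast_dotProduct]
    simp only [Pi.add_apply, Matrix.mulVec, dotProduct]
    congr 1
    · exact Finset.sum_congr rfl fun j _ => by rw [ih (by omega) j]; rfl
    · exact Finset.sum_congr rfl fun j _ => by rw [hX s hs' j]; rfl

/-- Growth of the intermediate values of one neuron: `Z` bounds the weights, the dimension, and 2,
so that an affine map multiplies a bound by at most `Z ^ 3`. -/
theorem abs_value_le (h : F.WeightsLE Z) (hcard : (Fintype.card ι : ℤ) ≤ Z) (hZ : 2 ≤ Z) {a : ℕ}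
    {y : ι → ℤ} (hy : ∀ i, |y i| ≤ Z ^ a) (k : ℕ) :
    |(F.gates.getD k .idle).w₁ ⬝ᵥ y + (F.gates.getD k .idle).b₁| ≤ Z ^ (a + 3) ∧
    |(F.gates.getD k .idle).w₂ ⬝ᵥ y + (F.gates.getD k .idle).b₂| ≤ Z ^ (a + 3) ∧
    |(F.gates.getD k .idle).value y| ≤ Z ^ (2 * a + 6) := by
  obtain ⟨h1, h2, h3, h4, -⟩ := h.getD (by linarith) k
  have hpa : 1 ≤ Z ^ a := one_le_pow₀ (by linarith)
  have aux : ∀ {v : ι → ℤ} {b : ℤ}, (∀ i, |v i| ≤ Z) → |b| ≤ Z → |v ⬝ᵥ y + b| ≤ Z ^ (a + 3) := by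
    intro v b hv hb
    have hd := abs_dotProduct_le (by linarith) hv hy
    have : (Fintype.card ι : ℤ) * (Z * Z ^ a) ≤ Z * (Z * Z ^ a) :=
      mul_le_mul_of_nonneg_right hcard (by positivity)
    calc |v ⬝ᵥ y + b| ≤ |v ⬝ᵥ y| + |b| := abs_add_le _ _
      _ ≤ Z * (Z * Z ^ a) + Z * (Z * Z ^ a) := by
        have : Z * 1 ≤ Z * (Z * Z ^ a) :=
          mul_le_mul_of_nonneg_left (one_le_mul_of_one_le_of_one_le (by linarith) hpa) (by linarith)
        linarith
      _ = 2 * (Z * (Z * Z ^ a)) := by ring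
      _ ≤ Z * (Z * (Z * Z ^ a)) := mul_le_mul_of_nonneg_right hZ (by positivity)
      _ = Z ^ (a + 3) := by ring
  have e1 := aux h1 h2
  have e2 := aux h3 h4
  refine ⟨e1, e2, ?_⟩
  rw [Gate.value, abs_mul, show 2 * a + 6 = (a + 3) + (a + 3) by ring, pow_add]
  refine mul_le_mul ?_ e2 (abs_nonneg _) (by positivity)
  rw [abs_of_nonneg (le_max_right _ _)]
  exact max_le (le_trans (le_abs_self _) e1) (by positivity)

theorem abs_ffn_le (h : F.WeightsLE Z) (hcard : (Fintype.card ι : ℤ) ≤ Z)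
    (hgates : (F.gates.length : ℤ) ≤ Z) (hZ : 2 ≤ Z) {a : ℕ}
    {y : ι → ℤ} (hy : ∀ i, |y i| ≤ Z ^ a) (i : ι) : |F.ffn y i| ≤ Z ^ (2 * a + 9) := by
  have hsum : |(F.gates.map fun g => g.out i * g.value y).sum|
      ≤ F.gates.length * (Z * Z ^ (2 * a + 6)) := by
    refine abs_list_sum_le _ _ fun g hg => ?_
    obtain ⟨k, hk, rfl⟩ := List.getElem_of_mem hg
    have hv := (abs_value_le h hcard hZ hy k).2.2
    rw [List.getD_eq_getElem _ _ hk] at hv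
    rw [abs_mul]
    exact mul_le_mul ((h.gates _ hg).2.2.2.2 i) hv (abs_nonneg _) (by linarith)
  have hp : 1 ≤ Z ^ (2 * a + 6) := one_le_pow₀ (by linarith)
  have : (F.gates.length : ℤ) * (Z * Z ^ (2 * a + 6)) ≤ Z * (Z * Z ^ (2 * a + 6)) :=
    mul_le_mul_of_nonneg_right hgates (by positivity)
  calc |F.ffn y i| ≤ _ + |F.bias i| := abs_add_le _ _
    _ ≤ Z * (Z * Z ^ (2 * a + 6)) + Z * (Z * Z ^ (2 * a + 6)) := by
      have h1 := h.bias i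
      have h2 : Z * 1 ≤ Z * (Z * Z ^ (2 * a + 6)) :=
        mul_le_mul_of_nonneg_left (one_le_mul_of_one_le_of_one_le (by linarith) hp) (by linarith)
      linarith
    _ = 2 * (Z * (Z * Z ^ (2 * a + 6))) := by ring
    _ ≤ Z * (Z * (Z * Z ^ (2 * a + 6))) := mul_le_mul_of_nonneg_right hZ (by positivity)
    _ = Z ^ (2 * a + 9) := by ring

theorem ffn_toBlock (h : F.WeightsLE Z) (hcard : (Fintype.card ι : ℤ) ≤ Z)
    (hgates : (F.gates.length : ℤ) ≤ Z) (hZ : 2 ≤ Z) {a q w : ℕ} (hw : F.gates.length ≤ w)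
    (hq : Z ^ (2 * a + 9) < 2 ^ q)
    {yr : ι → ℝ} {y : ι → ℤ} (hyr : ∀ i, yr i = y i) (hy : ∀ i, |y i| ≤ Z ^ a) (i : ι) :
    (F.toBlock w).ffn q yr i = F.ffn y i := by
  obtain rfl : yr = fun i => (y i : ℝ) := funext hyr
  have hpow : ∀ {e : ℕ}, e ≤ 2 * a + 9 → Z ^ e < 2 ^ q := fun he =>
    lt_of_le_of_lt (pow_le_pow_right₀ (by linarith) he) hq
  have hu : ∀ k : Fin w, rndVec q ((F.toBlock w).W₁.mulVec (fun i => (y i : ℝ)) +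
      (F.toBlock w).b₁) k =
      (((F.gates.getD k .idle).w₁ ⬝ᵥ y + (F.gates.getD k .idle).b₁ : ℤ) : ℝ) := by
    intro k
    rw [← rnd_intCast (lt_of_le_of_lt (abs_value_le h hcard hZ hy k).1 (hpow (by omega))),
      Int.cast_add, ← cast_dotProduct]
    rfl
  have hv : ∀ k : Fin w, rndVec q ((F.toBlock w).W₂.mulVec (fun i => (y i : ℝ)) +
      (F.toBlock w).b₂) k =
      (((F.gates.getD k .idle).w₂ ⬝ᵥ y + (F.gates.getD k .idle).b₂ : ℤ) : ℝ) := by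
    intro k
    rw [← rnd_intCast (lt_of_le_of_lt (abs_value_le h hcard hZ hy k).2.1 (hpow (by omega))),
      Int.cast_add, ← cast_dotProduct]
    rfl
  have hp : ∀ k : Fin w, rnd q (max (((F.gates.getD k .idle).w₁ ⬝ᵥ y +
      (F.gates.getD k .idle).b₁ : ℤ) : ℝ) 0 *
      (((F.gates.getD k .idle).w₂ ⬝ᵥ y + (F.gates.getD k .idle).b₂ : ℤ) : ℝ)) =
      (((F.gates.getD k .idle).value y : ℤ) : ℝ) := by
    intro k
    rw [← rnd_intCast (lt_of_le_of_lt (abs_value_le h hcard hZ hy k).2.2 (hpow (by omega)))]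
    simp [Gate.value]
  rw [Block.ffn, ← rnd_intCast (lt_of_le_of_lt (abs_ffn_le h hcard hgates hZ hy i) hq)]
  simp only [hu, hv]
  rw [rndVec]
  congr 1
  rw [IntBlock.ffn, Int.cast_add,
    ← sum_fin_getD F.gates .idle (fun g => g.out i * g.value y) (by simp [Gate.idle]) hw]
  rw [Pi.add_apply, Int.cast_sum]
  simp only [Matrix.mulVec, dotProduct, Int.cast_mul]
  congr 1
  refine Finset.sum_congr rfl fun k _ => ?_
  exact congrArg (((F.gates.getD k .idle).out i : ℝ) * ·) (hp k)

/-- Growth of the numbers in one block: a bound `Z ^ a` becomes `Z ^ (2 * a + 12)`. -/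
theorem abs_layer_le (h : F.WeightsLE Z) (hcard : (Fintype.card ι : ℤ) ≤ Z)
    (hgates : (F.gates.length : ℤ) ≤ Z) (hZ : 2 ≤ Z) {a : ℕ} {x y : ι → ℤ}
    (hx : ∀ i, |x i| ≤ Z ^ a) (hy : ∀ i, |y i| ≤ Z ^ a) (i : ι) :
    |x i + y i| ≤ Z ^ (a + 1) ∧ |x i + y i + F.ffn (x + y) i| ≤ Z ^ (2 * a + 12) := by
  have hxy : ∀ i, |x i + y i| ≤ Z ^ (a + 1) := by
    intro i
    calc |x i + y i| ≤ |x i| + |y i| := abs_add_le _ _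
      _ ≤ 2 * Z ^ a := by linarith [hx i, hy i]
      _ ≤ Z * Z ^ a := mul_le_mul_of_nonneg_right hZ (by positivity)
      _ = Z ^ (a + 1) := by ring
  refine ⟨hxy i, ?_⟩
  have hf := abs_ffn_le h hcard hgates hZ (y := x + y) hxy i
  have h1 : Z ^ (a + 1) ≤ Z ^ (2 * a + 11) := pow_le_pow_right₀ (by linarith) (by omega)
  calc _ ≤ |x i + y i| + |F.ffn (x + y) i| := abs_add_le _ _
    _ ≤ Z ^ (2 * a + 11) + Z ^ (2 * a + 11) :=
      add_le_add ((hxy i).trans h1) (hf.trans_eq (by ring))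
    _ = 2 * Z ^ (2 * a + 11) := by ring
    _ ≤ Z * Z ^ (2 * a + 11) := mul_le_mul_of_nonneg_right hZ (by positivity)
    _ = _ := by ring

/-- A block with integer weights computes exactly, as long as its input and its state stay below a
power of `Z` that is far below the range of the arithmetic. -/
theorem apply_toBlock (h : F.WeightsLE Z) (hcard : (Fintype.card ι : ℤ) ≤ Z)
    (hgates : (F.gates.length : ℤ) ≤ Z) (hZ : 2 ≤ Z) {a q w t : ℕ} (hw : F.gates.length ≤ w)
    (hq : Z ^ (2 * a + 12) < 2 ^ q) {Xr : ℕ → ι → ℝ} {X H : ℕ → ι → ℤ}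
    (hX : ∀ s ≤ t, ∀ i, Xr s i = X s i) (h0 : H 0 = 0)
    (hH : ∀ s ≤ t, ∀ i, H (s + 1) i = F.luA i ⬝ᵥ H s + F.luB i ⬝ᵥ X s)
    (hXb : ∀ i, |X t i| ≤ Z ^ a) (hHb : ∀ s ≤ t, ∀ i, |H (s + 1) i| ≤ Z ^ a) (i : ι) :
    (F.toBlock w).apply q Xr t i =
      ((X t i + H (t + 1) i + F.ffn (X t + H (t + 1)) i : ℤ) : ℝ) := by
  have hpow : ∀ {e : ℕ}, e ≤ 2 * a + 12 → Z ^ e < 2 ^ q := fun he =>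
    lt_of_le_of_lt (pow_le_pow_right₀ (by linarith) he) hq
  have hb := abs_layer_le h hcard hgates hZ hXb (hHb t le_rfl)
  have hyr : ∀ i, rndVec q (Xr t + (F.toBlock w).hidden q Xr (t + 1)) i =
      ((X t i + H (t + 1) i : ℤ) : ℝ) := by
    intro i
    rw [← rnd_intCast (lt_of_le_of_lt (hb i).1 (hpow (by omega))), rndVec, Pi.add_apply,
      hX t le_rfl, hidden_toBlock hX h0 hH
        (fun s hs i => lt_of_le_of_lt (hHb s hs i) (hpow (by omega))) _ le_rfl]
    push_cast
    rfl
  rw [← rnd_intCast (lt_of_le_of_lt (hb i).2 (hpow le_rfl)), Block.apply]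
  simp only [rndVec, Pi.add_apply]
  congr 1
  push_cast
  congr 1
  · have := hyr i
    simp only [rndVec, Pi.add_apply] at this
    rw [this]; push_cast; rfl
  · exact ffn_toBlock h hcard hgates hZ hw (hpow (by omega)) hyr (fun i => (hb i).1) i

/-- The same for a block whose input and state are given as functions `C` and `H` of the sequence
read so far, the last token first. -/
theorem apply_toBlock_of_reverse {α : Type} (h : F.WeightsLE Z)
    (hcard : (Fintype.card ι : ℤ) ≤ Z) (hgates : (F.gates.length : ℤ) ≤ Z) (hZ : 2 ≤ Z)
    {a q w : ℕ} (hw : F.gates.length ≤ w) (hq : Z ^ (2 * a + 12) < 2 ^ q) (S : List α)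
    {Xr : ℕ → ι → ℝ} {C H : List α → ι → ℤ}
    (hX : ∀ t < S.length, ∀ i, Xr t i = C (S.take (t + 1)).reverse i) (h0 : H [] = 0)
    (hH : ∀ s l i, H (s :: l) i = F.luA i ⬝ᵥ H l + F.luB i ⬝ᵥ C (s :: l))
    (hC : ∀ l, l ≠ [] → l.length ≤ S.length → ∀ i, |C l i| ≤ Z ^ a)
    (hHb : ∀ l, l.length ≤ S.length → ∀ i, |H l i| ≤ Z ^ a) (t : ℕ) (ht : t < S.length) (i : ι) :
    (F.toBlock w).apply q Xr t i =
      ((C (S.take (t + 1)).reverse i + H (S.take (t + 1)).reverse i +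
        F.ffn (C (S.take (t + 1)).reverse + H (S.take (t + 1)).reverse) i : ℤ) : ℝ) := by
  refine apply_toBlock (X := fun t => C (S.take (t + 1)).reverse)
    (H := fun t => H (S.take t).reverse) h hcard hgates hZ hw hq
    (fun s hs i => hX s (by omega) i) (by simp [h0]) ?_ ?_ ?_ i
  · intro s hs i
    rw [List.take_succ_eq_append_getElem (by omega), List.reverse_append]
    exact hH _ _ _
  · exact hC _ (by simp; intro h; simp [h] at ht) (by simp)
  · exact fun s hs i => hHb _ (by simp) i

end IntBlock

end RagRNN

namespace RagRNN

/-! ### The query and its regular expression -/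

namespace Regex

variable {B : ℕ}

/-- The expression `r` followed by the literal characters `w`. -/
def literal (w : List (Chr B)) (r : Regex B) : Regex B := w.foldl (fun a c => .seq a (.chr c)) r

/-- The expression `.*~ k\s`, in the form in which the parser returns it. -/
def writtenAt (k : ℕ) : Regex B :=
  .seq (literal (.tilde :: .rx .space :: decimal k) (.seq .eps (.star true .any))) .blank

/-- The expression `..(?:\S\s){k}`. In a text that begins with `<s> x₁ x₂ …`, the two dots read
`<s`, and `k` pairs read `> x₁ … xₖ₋₁` with the blanks, so that `xₖ` comes next. -/
def inputAt (k : ℕ) : Regex B :=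
  .seq (.seq (.seq .eps .any) .any) (.rep k (.seq (.seq .eps .nonblank) .blank))

/-- The expression `(\S)`. -/
def captureOne : Regex B := .group 1 (.seq .eps .nonblank)

/-- The expression `^(?:.*~ k\s|..(?:\S\s){k})(\S)`, which looks up the content of the tape cell
with label `k`: the symbol of the last record `~ k a`, or the `k`-th input symbol if there is no
such record. -/
def cellQuery (k : ℕ) : Regex B :=
  .seq (.seq (.seq .eps .atStart) (.alt (writtenAt k) (inputAt k))) captureOne

end Regex

section Parser

variable {B : ℕ}

/-- Literal characters pushed onto a frame. -/
def Frame.pushChars (f : Frame B) (w : List (Chr B)) : Frame B :=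
  w.foldl (fun f c => f.push (.chr c)) f

theorem Frame.pushChars_spec (w : List (Chr B)) (f : Frame B) :
    (f.pushChars w).number = f.number ∧ (f.pushChars w).alts = f.alts ∧
    (f.pushChars w).flush = Regex.literal w f.flush := by
  induction w generalizing f with
  | nil => exact ⟨rfl, rfl, rfl⟩
  | cons c w ih => exact ih (f.push (.chr c))

theorem foldlM_step_digits (D : List (Fin 10)) (g : ℕ) (st : List (Frame B)) (f : Frame B) :
    (D.map Chr.digit).foldlM PState.step ⟨.plain, g, st, f⟩ =
      some ⟨.plain, g, st, f.pushChars (D.map Chr.digit)⟩ := by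
  induction D generalizing f with
  | nil => rfl
  | cons d D ih =>
    simp only [List.map_cons, List.foldlM_cons]
    exact ih (f.push (.chr (.digit d)))

theorem foldlM_step_braces (D : List (Fin 10)) (m : ℕ) (g : ℕ) (st : List (Frame B))
    (f : Frame B) :
    (D.map Chr.digit).foldlM PState.step ⟨.braces (some m), g, st, f⟩ =
      some ⟨.braces (some (D.foldl (fun a d => a * 10 + d.val) m)), g, st, f⟩ := by
  induction D generalizing m with
  | nil => rfl
  | cons d D ih =>
    simp only [List.map_cons, List.foldlM_cons, List.foldl_cons]
    exact ih (m * 10 + d.val)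

/-- The decimal digits of a number, the leading one first. -/
def decimalDigits (k : ℕ) : List (Fin 10) :=
  (Nat.digits 10 k).reverse.map fun d => ⟨d % 10, Nat.mod_lt d (by norm_num)⟩

theorem decimal_eq (k : ℕ) : decimal k = (decimalDigits k).map (Chr.digit (B := B)) := by
  simp [decimal, decimalDigits]

theorem foldl_decimalDigits (k : ℕ) :
    (decimalDigits k).foldl (fun a d => a * 10 + d.val) 0 = k := by
  conv_rhs => rw [← Nat.ofDigits_digits 10 k, Nat.ofDigits_eq_foldr]
  rw [decimalDigits, List.foldl_map, List.foldl_reverse]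
  have : ∀ L : List ℕ, (∀ d ∈ L, d < 10) →
      L.foldr (fun d a => a * 10 + d % 10) 0 = L.foldr (fun x y => x + 10 * y) 0 := by
    intro L hL
    induction L with
    | nil => rfl
    | cons d L ih =>
      simp only [List.foldr_cons]
      rw [ih fun e he => hL e (by simp [he]), Nat.mod_eq_of_lt (hL d (by simp))]
      ring
  simpa using this _ fun d hd => Nat.digits_lt_base (by norm_num) hd

theorem decimalDigits_injective : Function.Injective decimalDigits := fun k l h => by
  rw [← foldl_decimalDigits k, h, foldl_decimalDigits]

theorem decimalDigits_ne_nil {k : ℕ} (hk : k ≠ 0) : decimalDigits k ≠ [] := by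
  simp [decimalDigits, Nat.digits_eq_nil_iff_eq_zero, hk]

/-- The characters of the query for the cell with label `k`. -/
def queryChars (k : ℕ) : List (Chr B) :=
  [.rx .caret, .rx .lpar, .rx .quest, .rx .colon, .rx .dot, .rx .star, .tilde, .rx .space] ++
  decimal k ++
  [.rx .bslash, .rx .smallS, .rx .bar, .rx .dot, .rx .dot, .rx .lpar, .rx .quest, .rx .colon,
    .rx .bslash, .rx .bigS, .rx .bslash, .rx .smallS, .rx .rpar, .rx .lbrace] ++
  decimal k ++
  [.rx .rbrace, .rx .rpar, .rx .lpar, .rx .bslash, .rx .bigS, .rx .rpar]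

/-- The parser is run on the parts of the query one after the other. Only the two decimal numbers
need an argument, the other parts are evaluated. -/
theorem parse_queryChars {k : ℕ} (hk : k ≠ 0) :
    Regex.parse (queryChars k : List (Chr B)) = some (Regex.cellQuery k) := by
  obtain ⟨d, D, hD⟩ := List.exists_cons_of_ne_nil (decimalDigits_ne_nil hk)
  have hfold := foldl_decimalDigits k
  rw [hD, List.foldl_cons] at hfold
  -- the frames after the literal part `.*~ k`
  set f0 : Frame B := ⟨none, none, .seq (.seq .eps (.star true .any)) (.chr .tilde),
    .item (.chr (.rx .space))⟩ with hf0
  obtain ⟨h1, h2, h3⟩ := f0.pushChars_spec (decimal k)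
  have e1 : [.rx .caret, .rx .lpar, .rx .quest, .rx .colon, .rx .dot, .rx .star, .tilde,
      .rx .space].foldlM PState.step (⟨.plain, 0, [], Frame.opening none⟩ : PState B) =
      some ⟨.plain, 0, [⟨none, none, .eps, .item .atStart⟩], f0⟩ := rfl
  have e2 : ∀ f : Frame B, [.rx .bslash, .rx .smallS, .rx .bar, .rx .dot, .rx .dot, .rx .lpar,
      .rx .quest, .rx .colon, .rx .bslash, .rx .bigS, .rx .bslash, .rx .smallS, .rx .rpar,
      .rx .lbrace].foldlM PState.step
        (⟨.plain, 0, [⟨none, none, .eps, .item .atStart⟩], f⟩ : PState B) =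
      some ⟨.braces none, 0, [⟨none, none, .eps, .item .atStart⟩],
        ⟨f.number, some (f.push .blank).body, .seq (.seq .eps .any) .any,
          .item (.seq (.seq .eps .nonblank) .blank)⟩⟩ := fun f => rfl
  have e3 : ∀ f : Frame B, (decimal k).foldlM PState.step
      (⟨.braces none, 0, [⟨none, none, .eps, .item .atStart⟩], f⟩ : PState B) =
      some ⟨.braces (some k), 0, [⟨none, none, .eps, .item .atStart⟩], f⟩ := by
    intro f
    rw [decimal_eq, hD, List.map_cons, List.foldlM_cons]
    refine (foldlM_step_braces D (0 * 10 + d.val) 0 _ f).trans ?_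
    rw [hfold]
  have e4 : ∀ r : Regex B, [.rx .rbrace, .rx .rpar, .rx .lpar, .rx .bslash, .rx .bigS,
      .rx .rpar].foldlM PState.step
        (⟨.braces (some k), 0, [⟨none, none, .eps, .item .atStart⟩],
        ⟨none, some r, .seq (.seq .eps .any) .any,
          .item (.seq (.seq .eps .nonblank) .blank)⟩⟩ : PState B) =
      some ⟨.plain, 1, [], ⟨none, none, .seq (.seq .eps .atStart) (.alt r (Regex.inputAt k)),
        .item Regex.captureOne⟩⟩ := fun r => rfl
  have hn : (f0.pushChars (decimal k)).number = none := h1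
  have ha : (f0.pushChars (decimal k)).alts = none := h2
  rw [Regex.parse, queryChars]
  simp only [List.foldlM_append, e1, Option.bind_eq_bind, Option.bind_some]
  rw [decimal_eq, foldlM_step_digits, ← decimal_eq]
  simp only [Option.bind_some, e2, e3, hn, e4, Frame.body, Frame.push, ha]
  have h4 : (f0.pushChars (decimal k)).flush =
      .literal (.tilde :: .rx .space :: decimal k) (.seq .eps (.star true .any)) := h3
  simp only [Frame.flush] at h4 ⊢
  rw [h4]
  rfl

end Parser

/-! ### What the query finds -/

section Matching

variable {B : ℕ}

/-- The value that the first of several matches captures. -/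
def capture (L : List (MState B)) : Option (Option (List (Chr B))) := L.head?.map MState.cap

theorem capture_append (L L' : List (MState B)) :
    capture (L ++ L') = (capture L).or (capture L') := by
  cases L <;> simp [capture]

/-- The value of `h` at the last suffix of a text at which `h` is defined. -/
def lastHit {α : Type} (h : List (Chr B) → Option α) : List (Chr B) → Option α
  | [] => h []
  | c :: w => (lastHit h w).or (h (c :: w))

/-- A greedy `.*` prefers the last position from which the remaining expression matches. -/
theorem capture_iter_any (f : MState B → List (MState B)) (h : List (Chr B) → Option _)
    (hf : ∀ p w, capture (f ⟨p, w, none⟩) = h w) (p w : List (Chr B)) :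
    capture ((Regex.matchFrom (.star true .any) ⟨p, w, none⟩).flatMap f) = lastHit h w := by
  rw [Regex.matchFrom]
  induction w generalizing p with
  | nil => simp [Regex.iter, lastHit, hf]
  | cons c w ih =>
    have := ih (c :: p)
    simp only [List.length_cons, Regex.iter, if_true, Regex.matchFrom, Regex.consume,
      List.flatMap_append, capture_append, List.flatMap_cons, List.flatMap_nil, List.append_nil,
      lastHit, hf] at this ⊢
    rw [this]

/-- The character captured by the literal text `w` followed by `\s(\S)`, at the beginning of a
text. -/
def hit : List (Chr B) → List (Chr B) → Option (Chr B)
  | [], s :: c :: _ => if s = .rx .space ∧ c ≠ .rx .space then some c else none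
  | [], _ => none
  | a :: w, c :: z => if c = a then hit w z else none
  | _ :: _, [] => none

theorem matchFrom_captureOne (p w : List (Chr B)) :
    Regex.matchFrom .captureOne ⟨p, w, none⟩ =
      match w with
      | [] => []
      | c :: w => if c ≠ .rx .space then [⟨c :: p, w, some [c]⟩] else [] := by
  cases w with
  | nil => simp [Regex.captureOne, Regex.matchFrom, Regex.consume]
  | cons c w =>
    by_cases hc : c = .rx .space <;>
    simp [Regex.captureOne, Regex.matchFrom, Regex.consume, hc]

/-- Match literal characters. -/
def eat : List (Chr B) → MState B → List (MState B)
  | [], st => [st]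
  | c :: w, st => (Regex.consume (fun x => decide (x = c)) st).flatMap (eat w)

theorem matchFrom_literal (w : List (Chr B)) (r : Regex B) (st : MState B) :
    Regex.matchFrom (.literal w r) st = (Regex.matchFrom r st).flatMap (eat w) := by
  induction w generalizing r with
  | nil => simp [Regex.literal, eat]
  | cons c w ih =>
    rw [Regex.literal, List.foldl_cons]
    refine (ih (.seq r (.chr c))).trans ?_
    simp only [Regex.matchFrom, List.flatMap_assoc]
    rfl

/-- The definition of `hit` is what backtracking computes. -/
theorem capture_eat (w z p : List (Chr B)) :
    capture (((eat w ⟨p, z, none⟩).flatMap (Regex.matchFrom .blank)).flatMap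
      (Regex.matchFrom .captureOne)) = (hit w z).map fun c => some [c] := by
  induction w generalizing z p with
  | nil =>
    rcases z with _ | ⟨s, _ | ⟨c, z⟩⟩
    · simp [eat, hit, Regex.matchFrom, Regex.consume, capture]
    · by_cases hs : s = .rx .space <;>
      simp [eat, hit, Regex.matchFrom, Regex.consume, capture, hs, matchFrom_captureOne]
    · by_cases hs : s = .rx .space <;> by_cases hc : c = .rx .space <;>
      simp [eat, hit, Regex.matchFrom, Regex.consume, capture, hs, hc, matchFrom_captureOne]
  | cons a w ih =>
    cases z with
    | nil => simp [eat, hit, Regex.consume, capture]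
    | cons c z =>
      by_cases hc : c = a
      · simp only [eat, Regex.consume, hc, hit, decide_true, if_true, List.flatMap_cons,
          List.flatMap_nil, List.append_nil]
        exact ih z (a :: p)
      · simp [eat, Regex.consume, hc, hit, capture]

theorem capture_writtenAt (k : ℕ) (w p : List (Chr B)) :
    capture ((Regex.matchFrom (.writtenAt k) ⟨p, w, none⟩).flatMap
      (Regex.matchFrom .captureOne)) =
      lastHit (fun z => (hit (.tilde :: .rx .space :: decimal k) z).map fun c => some [c]) w := by
  have h := capture_iter_any (B := B) (fun st => ((eat (.tilde :: .rx .space :: decimal k)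
    st).flatMap (Regex.matchFrom .blank)).flatMap (Regex.matchFrom .captureOne)) _
    (fun p z => capture_eat _ z p) p w
  rw [← h, Regex.writtenAt, Regex.matchFrom, matchFrom_literal]
  rw [Regex.matchFrom, Regex.matchFrom]
  simp only [List.flatMap_assoc, List.flatMap_cons, List.flatMap_nil, List.append_nil]

/-- The search starts at the beginning of the text only, because of the anchor `^`. -/
theorem search_cellQuery (k : ℕ) (w : List (Chr B)) :
    (Regex.search (.cellQuery k) w).map MState.cap =
      (lastHit (fun z => (hit (.tilde :: .rx .space :: decimal k) z).map fun c => some [c]) w).or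
      (capture ((Regex.matchFrom (.inputAt k) ⟨[], w, none⟩).flatMap
        (Regex.matchFrom .captureOne))) := by
  have h0 : Regex.matchFrom (.cellQuery k) ⟨[], w, none⟩ =
      (Regex.matchFrom (.writtenAt k) ⟨[], w, none⟩).flatMap (Regex.matchFrom .captureOne) ++
      (Regex.matchFrom (.inputAt k) ⟨[], w, none⟩).flatMap (Regex.matchFrom .captureOne) := by
    simp [Regex.cellQuery, Regex.matchFrom]
  have h1 : ∀ i ∈ List.range w.length,
      Regex.matchFrom (.cellQuery k) ⟨(w.take (i + 1)).reverse, w.drop (i + 1), none⟩ = [] := by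
    intro i hi
    have hne : w ≠ [] := by rintro rfl; simp at hi
    simp [Regex.cellQuery, Regex.matchFrom, hne]
  rw [Regex.search, List.range_succ_eq_map, List.flatMap_cons, List.flatMap_map,
    List.flatMap_eq_nil_iff.2 (by simpa using h1)]
  rw [← capture_writtenAt k w [], ← capture_append, ← h0]
  simp [capture]

/-- Two decimal numbers that are followed by a character other than a digit are compared as a
whole. -/
theorem hit_digits (D D' : List (Fin 10)) (c : Chr B) (hc : ∀ d, c ≠ .digit d)
    (z : List (Chr B)) :
    hit (D.map .digit) (D'.map .digit ++ c :: z) = if D = D' then hit [] (c :: z) else none := by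
  induction D generalizing D' with
  | nil =>
    cases D' with
    | nil => simp
    | cons d D' => cases D' <;> simp [hit]
  | cons d D ih =>
    cases D' with
    | nil => simp [hit, hc]
    | cons d' D' =>
      by_cases hd : d' = d
      · simp [hit, hd, ih]
      · simp [hit, hd, Ne.symm hd]

theorem hit_record (k k' : ℕ) (a : Fin B) (z : List (Chr B)) :
    hit (.tilde :: .rx .space :: decimal k)
      (.tilde :: .rx .space :: (decimal k' ++ .rx .space :: .sym a :: z)) =
      if k' = k then some (.sym a) else none := by
  simp only [hit, if_true, decimal_eq]
  rw [hit_digits _ _ _ (by simp)]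
  simp [hit, decimalDigits_injective.eq_iff, eq_comm]

/-- A query contains `~ k\s` but no blank after the number, so that it is not taken for a record. -/
theorem hit_query (k k' : ℕ) (z : List (Chr B)) :
    hit (.tilde :: .rx .space :: decimal k)
      (.tilde :: .rx .space :: (decimal k' ++ .rx .bslash :: z)) = none := by
  simp only [hit, if_true, decimal_eq]
  rw [hit_digits _ _ _ (by simp)]
  cases z <;> simp [hit]

/-- Only at the character `~` can a record begin. -/
theorem lastHit_hit_cons_of_ne {α : Type} (g : Chr B → α) (w : List (Chr B)) {c : Chr B}
    (hc : c ≠ .tilde) (z : List (Chr B)) :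
    lastHit (fun z => (hit (.tilde :: w) z).map g) (c :: z) =
      lastHit (fun z => (hit (.tilde :: w) z).map g) z := by
  simp [lastHit, hit, hc]

theorem lastHit_hit_append {α : Type} (g : Chr B → α) (w u : List (Chr B))
    (hu : .tilde ∉ u) (z : List (Chr B)) :
    lastHit (fun z => (hit (.tilde :: w) z).map g) (u ++ z) =
      lastHit (fun z => (hit (.tilde :: w) z).map g) z := by
  induction u with
  | nil => rfl
  | cons c u ih =>
    simp only [List.mem_cons, not_or] at hu
    rw [List.cons_append, lastHit_hit_cons_of_ne g w (Ne.symm hu.1), ih hu.2]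

/-- Skipping `k` words of one character. A word `x` followed directly by `+` stops this. -/
theorem capture_iterExact_words (x : List (Fin B)) (z : List (Chr B)) (k : ℕ) (c : Chr B)
    (hc : c ≠ .rx .space) (p : List (Chr B)) :
    capture ((Regex.iterExact (Regex.matchFrom (.seq (.seq .eps .nonblank) .blank)) k
      ⟨p, c :: (x.flatMap (fun a => [.rx .space, .sym a]) ++ .rx .plus :: z), none⟩).flatMap
        (Regex.matchFrom .captureOne)) =
      ((c :: x.map Chr.sym)[k]?).map fun d => some [d] := by
  induction k generalizing x c p with
  | zero => simp [Regex.iterExact, matchFrom_captureOne, hc, capture]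
  | succ k ih =>
    cases x with
    | nil => simp [Regex.iterExact, Regex.matchFrom, Regex.consume, hc, capture]
    | cons a x =>
      have := ih x (.sym a) (by simp) (.rx .space :: c :: p)
      rw [Regex.iterExact]
      simpa [Regex.matchFrom, Regex.consume, hc] using this

theorem capture_inputAt (x : List (Fin B)) (z : List (Chr B)) (k : ℕ) :
    capture ((Regex.matchFrom (.inputAt k) ⟨[], .lt :: .rx .smallS :: .gt ::
      (x.flatMap (fun a => [.rx .space, .sym a]) ++ .rx .plus :: z), none⟩).flatMap
        (Regex.matchFrom .captureOne)) =
      ((.gt :: x.map Chr.sym)[k]?).map fun d => some [d] := by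
  rw [← capture_iterExact_words x z k .gt (by simp) [.rx .smallS, .lt]]
  simp [Regex.inputAt, Regex.matchFrom, Regex.consume]

end Matching

end RagRNN

namespace RagRNN

/-! ### The text of a chain of thought -/

variable {B N : ℕ}

/-- A token given by its code: a special token, or the number `k` if there is no code. -/
def Tok.ofCode (k : Fin N) : Option (Special B) → Tok B N
  | none => .num k
  | some s => .spec s

/-- The codes of the tokens of a query, without the search delimiters. -/
def queryCode : List (Option (Special B)) :=
  [some (.rx .caret), some (.rx .lpar), some (.rx .quest), some (.rx .colon), some (.rx .dot),
    some (.rx .star), some (.ctl .edge), none, some (.rx .bslash), some (.rx .smallS),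
    some (.rx .bar), some (.rx .dot), some (.rx .dot), some (.rx .lpar), some (.rx .quest),
    some (.rx .colon), some (.rx .bslash), some (.rx .bigS), some (.rx .bslash),
    some (.rx .smallS), some (.rx .rpar), some (.rx .lbrace), none, some (.rx .rbrace),
    some (.rx .rpar), some (.rx .lpar), some (.rx .bslash), some (.rx .bigS), some (.rx .rpar)]

theorem detokenize_query (k : Fin N) :
    Tok.detokenize (queryCode.map (Tok.ofCode (B := B) k)) = queryChars (k + 1) := by
  simp [queryCode, Tok.ofCode, Tok.detokenize, queryChars, Tok.chars, Tok.isWord, Ctl.chars]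

/-- The content of a cell as a special token. -/
def readSpecial : Option (Fin B) → Special B
  | some a => .sym a
  | none => .ctl .failed

/-- The special token that stands for a move to the right (`true`) or to the left. These tokens are
regular-expression characters, so that no blank separates them from the word before: after the
input, this keeps the expression `(?:\S\s){k}` from running past the last input symbol. -/
def moveSpecial (right : Bool) : Special B := .rx (if right = true then .plus else .dollar)

/-- What the chain of thought says about one step of a Turing machine: the label of the scanned
cell, its content, the symbol written, the direction of the move and the next state. -/
structure Record (B N : ℕ) where
  label : Fin N
  read : Option (Fin B)
  symbol : Fin B
  right : Bool
  state : Fin B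

/-- The tokens of a step: the query for the scanned cell with its result, and the record
`~ k a` followed by the move and the next state. -/
def Record.toks (r : Record B N) : List (Tok B N) :=
  .spec (.ctl .startSearch) :: queryCode.map (Tok.ofCode r.label) ++
    [.spec (.ctl .endSearch), .spec (readSpecial r.read), .spec (.ctl .edge), .num r.label,
      .spec (.sym r.symbol), .spec (moveSpecial r.right), .spec (.sym r.state)]

/-- The sequence of tokens after the steps in `L`, for the input `x` and the initial state `s`. -/
def history (x : List (Fin B)) (s : Fin B) (L : List (Record B N)) : List (Tok B N) :=
  inputSeq x ++ [.spec (moveSpecial true), .spec (.sym s)] ++ L.flatMap Record.toks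

/-- The symbol that the last record for the cell with label `k` says. -/
def lastWrite (k : Fin N) : List (Record B N) → Option (Fin B)
  | [] => none
  | r :: L => (lastWrite k L).or (if r.label = k then some r.symbol else none)

theorem lastWrite_append (k : Fin N) (L : List (Record B N)) (r : Record B N) :
    lastWrite k (L ++ [r]) = if r.label = k then some r.symbol else lastWrite k L := by
  induction L with
  | nil => simp [lastWrite]
  | cons r' L ih =>
    rw [List.cons_append, lastWrite, ih, lastWrite]
    split_ifs <;> simp

theorem tilde_notMem_decimal (k : ℕ) : (.tilde : Chr B) ∉ decimal k := by
  simp [decimal]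

theorem lastHit_hit_tilde {α : Type} (g : Chr B → α) (w z : List (Chr B)) :
    lastHit (fun z => (hit (.tilde :: w) z).map g) (.tilde :: z) =
      (lastHit (fun z => (hit (.tilde :: w) z).map g) z).or
        ((hit (.tilde :: w) (.tilde :: z)).map g) := rfl

theorem detokenize_cons_cons (s s' : Tok B N) (S : List (Tok B N)) :
    Tok.detokenize (s :: s' :: S) =
      s.chars ++ (if s.isWord && s'.isWord then [.rx .space] else []) ++
        Tok.detokenize (s' :: S) := by
  rw [Tok.detokenize]

theorem chars_readSpecial (o : Option (Fin B)) :
    .tilde ∉ (Tok.spec (readSpecial o) : Tok B N).chars := by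
  cases o <;> simp [readSpecial, Tok.chars, Ctl.chars]

/-- In the text of a chain of thought, the last place where `.*~ k\s(\S)` matches is the last record
for the cell with label `k`: earlier queries contain no blank after the number. -/
theorem lastHit_records (k : Fin N) (s : Fin B) (L : List (Record B N)) :
    lastHit (fun z => (hit (.tilde :: .rx .space :: decimal (k + 1)) z).map fun c => some [c])
      (Tok.detokenize (.spec (.sym s) :: L.flatMap Record.toks)) =
      (lastWrite k L).map fun a => some [.sym a] := by
  induction L generalizing s with
  | nil => simp [Tok.detokenize, Tok.chars, lastHit, hit, lastWrite]
  | cons r L ih =>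
    have hr := chars_readSpecial (N := N) r.read
    have hw : (Tok.spec (readSpecial r.read) : Tok B N).isWord = true := by
      cases r.read <;> rfl
    have hm : (Tok.spec (moveSpecial r.right) : Tok B N).chars =
        [.rx (if r.right = true then .plus else .dollar)] := rfl
    have hm' : (Tok.spec (moveSpecial r.right) : Tok B N).isWord = false := rfl
    have hlab : ((r.label : ℕ) + 1 = k + 1) ↔ r.label = k := by
      rw [Nat.add_right_cancel_iff, Fin.ext_iff]
    simp only [List.flatMap_cons, Record.toks, queryCode, Tok.ofCode, List.map_cons, List.map_nil,
      List.cons_append, List.nil_append, detokenize_cons_cons, hm, hm', hw,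
      show ∀ i : Fin N, (Tok.num i : Tok B N).chars = decimal (i + 1) from fun _ => rfl,
      show ∀ c, (Tok.spec (.rx c) : Tok B N).chars = [.rx c] from fun _ => rfl,
      show ∀ c, (Tok.spec (.sym c) : Tok B N).chars = [.sym c] from fun _ => rfl,
      show ∀ c, (Tok.spec (.ctl c) : Tok B N).chars = c.chars from fun _ => rfl,
      show ∀ i : Fin N, (Tok.num i : Tok B N).isWord = true from fun _ => rfl,
      show ∀ c, (Tok.spec (.rx c) : Tok B N).isWord = false from fun _ => rfl,
      show ∀ c, (Tok.spec (.sym c) : Tok B N).isWord = true from fun _ => rfl,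
      show ∀ c, (Tok.spec (.ctl c) : Tok B N).isWord = true from fun _ => rfl,
      Ctl.chars, Bool.and_self, Bool.and_false, Bool.false_and, if_true, Bool.false_eq_true,
      if_false, List.append_assoc]
    simp only [lastHit_hit_cons_of_ne, lastHit_hit_append _ _ _ (tilde_notMem_decimal _),
      lastHit_hit_append _ _ _ hr, lastHit_hit_tilde, hit_query, hit_record, hlab, ih,
      ne_eq, reduceCtorEq, not_false_eq_true, Option.map_none, Option.or_none, lastWrite]
    split_ifs <;> cases lastWrite k L <;> rfl

/-- The text begins with `<s> x₁ … xₙ+`, without a blank before `+`. -/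
theorem detokenize_history (x : List (Fin B)) (s : Fin B) (L : List (Record B N)) :
    Tok.detokenize (history x s L) = .lt :: .rx .smallS :: .gt ::
      (x.flatMap (fun a => [.rx .space, .sym a]) ++ .rx .plus ::
        Tok.detokenize (.spec (.sym s) :: L.flatMap Record.toks)) := by
  have key : ∀ (t : Tok B N) (x : List (Fin B)) (S : List (Tok B N)), t.isWord = true →
      Tok.detokenize (t :: x.map (fun i => .spec (.sym i)) ++
        .spec (moveSpecial true) :: .spec (.sym s) :: S) =
      t.chars ++ (x.flatMap (fun a => [.rx .space, .sym a]) ++ .rx .plus ::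
        Tok.detokenize (.spec (.sym s) :: S)) := by
    intro t x S ht
    induction x generalizing t with
    | nil =>
      simp [detokenize_cons_cons, Tok.isWord, moveSpecial, Tok.chars]
    | cons a x ih =>
      have := ih (.spec (.sym a)) rfl
      rw [List.map_cons, List.cons_append, List.cons_append, detokenize_cons_cons,
        ← List.cons_append, this]
      simp [ht, show (Tok.spec (.sym a) : Tok B N).isWord = true from rfl, Tok.chars]
  have := key (.spec (.ctl .bos)) x (L.flatMap Record.toks) rfl
  simpa [history, inputSeq, Tok.chars, Ctl.chars] using this

theorem splitQuery_append (U Q : List (Tok B N)) (hQ : .spec (.ctl .startSearch) ∉ Q) :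
    splitQuery (U ++ .spec (.ctl .startSearch) :: Q) = some (U, Q) := by
  have h0 : splitQuery Q = none := by
    induction Q with
    | nil => rfl
    | cons s Q ih =>
      simp only [List.mem_cons, not_or] at hQ
      rw [splitQuery, ih hQ.2]
      simp [Ne.symm hQ.1]
  induction U with
  | nil => simp [splitQuery, h0]
  | cons s U ih => simp [splitQuery, ih]

/-- A captured tape symbol has only one tokenization. -/
theorem tokenize_sym (a : Fin B) :
    Tok.tokenize [.sym a] = some [(.spec (.sym a) : Tok B N)] := by
  have hex : ∃ S : List (Tok B N), (∀ s ∈ S, s.isWord = true) ∧ Tok.detokenize S = [.sym a] :=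
    ⟨[.spec (.sym a)], by simp [Tok.isWord], by simp [Tok.detokenize, Tok.chars]⟩
  rw [Tok.tokenize, dif_pos hex]
  obtain ⟨hw, hd⟩ := hex.choose_spec
  generalize hex.choose = S at hw hd
  rcases S with _ | ⟨s, _ | ⟨s', S⟩⟩
  · simp [Tok.detokenize] at hd
  · rw [Tok.detokenize] at hd
    rcases s with k | (b | c | c)
    · simp only [Tok.chars, decimal_eq] at hd
      rcases h : decimalDigits (k + 1) with _ | ⟨d, D⟩ <;> simp [h] at hd
    · simpa [Tok.chars] using hd
    · cases c <;> simp [Tok.chars, Ctl.chars] at hd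
    · simp [Tok.chars] at hd
  · have hmem : .rx .space ∈ ([.sym a] : List (Chr B)) := by
      rw [← hd, detokenize_cons_cons, hw s (by simp), hw s' (by simp)]
      simp
    simp at hmem

/-- The query for the cell with label `k + 1` finds the symbol written there last, or else the
input symbol on the cell `k + 1`; if there is neither, it fails, which stands for an empty cell. -/
theorem retrieve_history (x : List (Fin B)) (s : Fin B) (L : List (Record B N)) (k : Fin N) :
    retrieve (history x s L ++ .spec (.ctl .startSearch) :: queryCode.map (Tok.ofCode k)) =
      some [.spec (readSpecial ((lastWrite k L).or x[(k : ℕ)]?))] := by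
  have hs : .spec (.ctl .startSearch) ∉ queryCode.map (Tok.ofCode (B := B) k) := by
    simp [queryCode, Tok.ofCode]
  have hsearch := search_cellQuery (k + 1) (Tok.detokenize (history x s L))
  rw [detokenize_history, lastHit_hit_cons_of_ne _ _ (by simp),
    lastHit_hit_cons_of_ne _ _ (by simp), lastHit_hit_cons_of_ne _ _ (by simp),
    lastHit_hit_append _ _ _ (by simp), lastHit_hit_cons_of_ne _ _ (by simp),
    lastHit_records, capture_inputAt, ← detokenize_history, List.getElem?_cons_succ,
    List.getElem?_map] at hsearch
  rw [retrieve, splitQuery_append _ _ hs, Option.bind_some, detokenize_query,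
    parse_queryChars (Nat.succ_ne_zero _), Option.bind_some]
  have hsome : ∀ a, (Regex.search (.cellQuery (k + 1)) (Tok.detokenize (history x s L))).map
      MState.cap = some (some [.sym a]) →
      (match Regex.search (.cellQuery (k + 1)) (Tok.detokenize (history x s L)) with
        | none => some [(.spec (.ctl .failed) : Tok B N)]
        | some st => st.cap.bind Tok.tokenize) = some [.spec (.sym a)] := by
    intro a h
    obtain ⟨st, h1, h2⟩ := Option.map_eq_some_iff.1 h
    rw [h1]
    simp only [h2, Option.bind_some, tokenize_sym]
  rcases hl : lastWrite k L with _ | a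
  · rcases hx : x[(k : ℕ)]? with _ | a
    · rw [hl, hx] at hsearch
      have : Regex.search (.cellQuery (k + 1)) (Tok.detokenize (history x s L)) = none := by
        simpa using hsearch
      rw [this]
      rfl
    · rw [hl, hx] at hsearch
      exact hsome a hsearch
  · rw [hl] at hsearch
    exact hsome a hsearch

end RagRNN

namespace RagRNN

/-! ### Neurons and coordinates -/

section Gates

variable {ι : Type}

/-- The neuron that adds `ReLU (a x + b)` times a vector. -/
def Gate.relu (a : ι → ℤ) (b : ℤ) (out : ι → ℤ) : Gate ι := ⟨a, b, 0, 1, out⟩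

/-- The neuron that adds `a x` times a vector. -/
def Gate.linear (a : ι → ℤ) (out : ι → ℤ) : Gate ι := ⟨0, 1, a, 0, out⟩

variable [Fintype ι]

@[simp] theorem Gate.value_relu (a : ι → ℤ) (b : ℤ) (out y : ι → ℤ) :
    (Gate.relu a b out).value y = max (a ⬝ᵥ y + b) 0 := by
  simp [Gate.relu, Gate.value]

@[simp] theorem Gate.value_linear (a out y : ι → ℤ) :
    (Gate.linear a out).value y = a ⬝ᵥ y := by
  simp [Gate.linear, Gate.value]

variable [DecidableEq ι]

/-- Neurons that write the truth value of `a x = v` to the coordinate `c`: for integers `y`, the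
second difference `ReLU (y + 1) - 2 ReLU y + ReLU (y - 1)` is the indicator of `y = 0`. -/
def eqGates (a : ι → ℤ) (v : ℤ) (c : ι) : List (Gate ι) :=
  [.relu a (1 - v) (Pi.single c 1), .relu a (-v) (Pi.single c (-2)),
    .relu a (-1 - v) (Pi.single c 1)]

theorem sum_eqGates (a : ι → ℤ) (v : ℤ) (c : ι) (y : ι → ℤ) (i : ι) :
    ((eqGates a v c).map fun g => g.out i * g.value y).sum =
      if i = c then (if a ⬝ᵥ y = v then 1 else 0) else 0 := by
  simp only [eqGates, List.map_cons, List.map_nil, List.sum_cons, List.sum_nil, Gate.value_relu]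
  simp only [Gate.relu, Pi.single_apply]
  generalize a ⬝ᵥ y = x
  split_ifs <;> omega

end Gates

theorem sum_map_flatMap {α β : Type*} (L : List α) (f : α → List β) (g : β → ℤ) :
    ((L.flatMap f).map g).sum = (L.map fun a => ((f a).map g).sum).sum := by
  induction L with
  | nil => rfl
  | cons a L ih => simp [ih]

/-- The coordinates used in addition to those of the embedding. -/
inductive Work (B : ℕ)
  /-- the symbol read `i` tokens ago -/
  | delay (i : Fin 33)
  /-- whether the token read `i` tokens ago is `<EndSearch>` -/
  | ended (i : Fin 2)
  /-- the position of the head -/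
  | head
  /-- whether the current state is `j` -/
  | oneHot (j : Fin B)
  /-- whether the input ends at this token -/
  | start
  /-- the label of the scanned cell -/
  | label
  /-- the `i`-th of the tokens that depend on the state and the scanned symbol -/
  | table (i : Fin 5)
  /-- the token to be generated `i` tokens later -/
  | chain (i : Fin 36)
  deriving DecidableEq, Fintype

/-- The number of additional coordinates. -/
abbrev extraDim (B : ℕ) : ℕ := Fintype.card (Work B)

variable {B N : ℕ}

/-- The position of an additional coordinate in the embedding space. -/
noncomputable def wk (w : Work B) : Coord B (extraDim B) := .work (Fintype.equivFin _ w)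

/-- A vector that is supported on the additional coordinates. -/
noncomputable def workVec {M : Type} [Zero M] (f : Work B → M) : Coord B (extraDim B) → M
  | .work j => f ((Fintype.equivFin _).symm j)
  | _ => 0

@[simp] theorem workVec_wk {M : Type} [Zero M] (f : Work B → M) (w : Work B) :
    workVec f (wk w) = f w := by
  simp [workVec, wk]

@[simp] theorem wk_inj {v w : Work B} : wk v = wk w ↔ v = w := by
  simp [wk]

theorem coord_cases {P : Coord B (extraDim B) → Prop} (h1 : P .num) (h2 : P .numSq)
    (h3 : ∀ s, P (.special s)) (h4 : ∀ w, P (wk w)) (h5 : P .pos) (i) : P i := by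
  cases i with
  | num => exact h1
  | numSq => exact h2
  | special s => exact h3 s
  | work j => simpa [wk] using h4 ((Fintype.equivFin _).symm j)
  | pos => exact h5

/-- A vector that is supported on the coordinates of the special tokens. -/
def specialVec (g : Special B → ℤ) : Coord B (extraDim B) → ℤ
  | .special s => g s
  | _ => 0

/-- The value of a number token, and 0 for a special token. -/
def Tok.number : Tok B N → ℤ
  | .num i => i + 1
  | .spec _ => 0

/-- A function of special tokens, extended by 0 to numbers. -/
def Tok.extend (g : Special B → ℤ) : Tok B N → ℤ
  | .num _ => 0
  | .spec s => g s

/-- The column of the token `s` at position `l`, with given additional coordinates. -/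
noncomputable def column (s : Tok B N) (l : ℤ) (f : Work B → ℤ) : Coord B (extraDim B) → ℤ
  | .num => s.number
  | .numSq => s.number ^ 2
  | .special s' => if s = .spec s' then 1 else 0
  | .work j => f ((Fintype.equivFin _).symm j)
  | .pos => l

@[simp] theorem column_wk (s : Tok B N) (l : ℤ) (f : Work B → ℤ) (w : Work B) :
    column s l f (wk w) = f w := by
  simp [column, wk]

@[simp] theorem specialVec_dotProduct_column (g : Special B → ℤ) (s : Tok B N) (l : ℤ)
    (f : Work B → ℤ) : specialVec g ⬝ᵥ column s l f = s.extend g := by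
  cases s with
  | num i =>
    rw [dotProduct, Finset.sum_eq_zero]
    · rfl
    · intro c _
      cases c <;> simp [specialVec, column]
  | spec s =>
    rw [dotProduct, Finset.sum_eq_single (.special s)]
    · simp [specialVec, column, Tok.extend]
    · intro c _ hc
      cases c with
      | special s' =>
        have : s ≠ s' := fun h => hc (by rw [h])
        simp [specialVec, column, this]
      | _ => simp [specialVec]
    · simp

/-- The column of the last token of a sequence, which is given in reversed order, the additional
coordinates being given as a function of the sequence. -/
noncomputable def lastColumn (f : List (Tok B N) → Work B → ℤ) :
    List (Tok B N) → Coord B (extraDim B) → ℤ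
  | [] => 0
  | s :: l => column s (l.length + 1) (f (s :: l))

/-! ### The first block: finite memory, state and head position -/

/-- The number `a + 1` for the tape symbol `a`. -/
def stateCode : Special B → ℤ
  | .sym a => a + 1
  | _ => 0

/-- The indicator of `<EndSearch>`. -/
def endCode (s : Special B) : ℤ := if s = .ctl .endSearch then 1 else 0

/-- The displacement of the head that a token stands for. -/
def moveCode : Special B → ℤ
  | .rx .plus => 1
  | .rx .dollar => -1
  | _ => 0

/-- The number of a special token, a positive integer. -/
noncomputable def tokenCode (s : Special B) : ℤ := Fintype.equivFin (Special B) s + 1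

/-- The value that `g` takes at the token read `i` tokens ago. -/
def seenAt (g : Special B → ℤ) (l : List (Tok B N)) (i : ℕ) : ℤ := (l[i]?).elim 0 (Tok.extend g)

theorem seenAt_nil (g : Special B → ℤ) (i : ℕ) : seenAt g ([] : List (Tok B N)) i = 0 := by
  simp [seenAt]

theorem seenAt_cons_zero (g : Special B → ℤ) (s : Tok B N) (l : List (Tok B N)) :
    seenAt g (s :: l) 0 = s.extend g := rfl

theorem seenAt_cons_succ (g : Special B → ℤ) (s : Tok B N) (l : List (Tok B N)) (i : ℕ) :
    seenAt g (s :: l) (i + 1) = seenAt g l i := rfl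

/-- The head position after the moves in a sequence of tokens. -/
def headPos (l : List (Tok B N)) : ℤ := (l.map (Tok.extend moveCode)).sum

/-- The label of the cell `p`: the cells `1, …, T + 1` are labelled by themselves, the cells
`0, -1, …` by the numbers from `T + 2` on. Written with three ReLUs, as the network computes it. -/
def cellLabel (T : ℕ) (p : ℤ) : ℤ :=
  max p 0 + (T + 2) * max (1 - p) 0 - (T + 1) * max (-p) 0

theorem cellLabel_of_pos (T : ℕ) {p : ℤ} (hp : 1 ≤ p) : cellLabel T p = p := by
  rw [cellLabel, max_eq_left (by omega), max_eq_right (by omega : 1 - p ≤ 0),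
    max_eq_right (by omega : -p ≤ 0)]
  ring

theorem cellLabel_of_nonpos (T : ℕ) {p : ℤ} (hp : p ≤ 0) : cellLabel T p = T + 2 - p := by
  rw [cellLabel, max_eq_right (by omega), max_eq_left (by omega : 0 ≤ 1 - p),
    max_eq_left (by omega : 0 ≤ -p)]
  ring

/-- The state of the linear unit of the first block. -/
noncomputable def memory₁ (l : List (Tok B N)) : Work B → ℤ
  | .delay i => seenAt stateCode l i
  | .ended i => seenAt endCode l i
  | .head => headPos l
  | _ => 0

/-- The additional coordinates after the first block. -/
noncomputable def features₁ (n T : ℕ) (l : List (Tok B N)) : Work B → ℤ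
  | .oneHot j => if seenAt stateCode l 32 = j + 1 then 1 else 0
  | .start => if (l.length : ℤ) = n + 1 then 1 else 0
  | .label => cellLabel T (headPos l)
  | w => memory₁ l w

/-- The first block: delay lines, a counter for the head position, the current state in one-hot
form, the detection of the end of the input, and the label of the scanned cell. -/
noncomputable def block₁ (B n T : ℕ) : IntBlock (Coord B (extraDim B)) where
  luA := workVec fun
    | .delay i => if h : 0 < i.val then Pi.single (wk (.delay ⟨i - 1, by omega⟩)) 1 else 0
    | .ended i => if h : 0 < i.val then Pi.single (wk (.ended ⟨i - 1, by omega⟩)) 1 else 0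
    | .head => Pi.single (wk .head) 1
    | _ => 0
  luB := workVec fun
    | .delay i => if i.val = 0 then specialVec stateCode else 0
    | .ended i => if i.val = 0 then specialVec endCode else 0
    | .head => specialVec moveCode
    | _ => 0
  gates :=
    (Finset.univ.toList.flatMap fun j : Fin B =>
      eqGates (Pi.single (wk (.delay 32)) 1) (j + 1) (wk (.oneHot j))) ++
    eqGates (Pi.single .pos 1) (n + 1) (wk .start) ++
    [.relu (Pi.single (wk .head) 1) 0 (Pi.single (wk .label) 1),
      .relu (Pi.single (wk .head) (-1)) 1 (Pi.single (wk .label) (T + 2)),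
      .relu (Pi.single (wk .head) (-1)) 0 (Pi.single (wk .label) (-(T + 1)))]
  bias := 0

/-- The recursion of the first linear unit. -/
theorem memory₁_cons (n T : ℕ) (s : Tok B N) (l : List (Tok B N)) (i) :
    workVec (memory₁ (s :: l)) i = (block₁ B n T).luA i ⬝ᵥ workVec (memory₁ l) +
      (block₁ B n T).luB i ⬝ᵥ lastColumn (fun _ => 0) (s :: l) := by
  rw [lastColumn]
  induction i using coord_cases with
  | h4 w =>
    simp only [block₁, workVec_wk]
    cases w with
    | delay i =>
      obtain ⟨_ | i, hi⟩ := i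
      · simp [memory₁, seenAt_cons_zero]
      · simp [memory₁, seenAt_cons_succ]
    | ended i =>
      obtain ⟨_ | i, hi⟩ := i
      · simp [memory₁, seenAt_cons_zero]
      · simp [memory₁, seenAt_cons_succ]
    | head => simp [memory₁, headPos, add_comm]
    | _ => simp [memory₁]
  | _ => simp [block₁, workVec]

/-- The columns after the first block. -/
theorem features₁_eq (n T : ℕ) (l : List (Tok B N)) (hl : l ≠ []) (i) :
    lastColumn (fun _ => 0) l i + workVec (memory₁ l) i +
      (block₁ B n T).ffn (lastColumn (fun _ => 0) l + workVec (memory₁ l)) i =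
      lastColumn (features₁ n T) l i := by
  obtain ⟨s, l, rfl⟩ := List.exists_cons_of_ne_nil hl
  simp only [IntBlock.ffn, block₁, List.map_append, List.sum_append, sum_map_flatMap, sum_eqGates,
    Finset.sum_map_toList, List.map_cons, List.map_nil, List.sum_cons, List.sum_nil,
    Gate.value_relu, single_dotProduct, Pi.add_apply, lastColumn, Pi.zero_apply]
  simp only [Gate.relu, workVec_wk, column_wk, Pi.zero_apply, zero_add, one_mul, neg_mul]
  induction i using coord_cases with
  | h4 w =>
    simp only [workVec_wk, column_wk, wk_inj, Pi.single_apply]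
    cases w with
    | oneHot j => simp [features₁, memory₁]
    | start => simp [features₁, memory₁, workVec, column]
    | label => simp [features₁, memory₁, cellLabel]; ring_nf
    | _ => simp [features₁, memory₁]
  | _ => simp [workVec, column, wk]

/-! ### The second block: the transition table -/

/-- The tape content for which a token stands as the result of a query. -/
def Special.content : Special B → Option (Fin B)
  | .sym a => some a
  | _ => none

/-- The entry of a list of codes, as a number; missing entries and numbers have the value 0. -/
noncomputable def codeAt (L : List (Option (Special B))) (i : ℕ) : ℤ :=
  ((L[i]?).getD none).elim 0 tokenCode

/-- The codes of the tokens to be generated when the machine is in state `q` and reads `c`: the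
answer or the beginning of a record, the label of the cell, the new symbol, the move and the new
state. -/
def stepCode (M : TM B) (q : Fin B) (c : Option (Fin B)) : List (Option (Special B)) :=
  [some (.ctl (if M.halting q = true then (if M.verdict q c = true then .yes else .no)
      else .edge)),
    none, some (.sym (M.trans q c).2.1), some (moveSpecial (M.trans q c).2.2),
    some (.sym (M.trans q c).1)]

/-- The `i`-th of the tokens to be generated after the result of a query, as a number. The state was
read 32 tokens before the result, and `<EndSearch>` directly before it; the ReLU is the conjunction
of the two conditions. -/
noncomputable def tableEntry (M : TM B) (l : List (Tok B N)) (i : ℕ) : ℤ :=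
  ∑ j : Fin B, max ((if seenAt stateCode l 32 = j + 1 then 1 else 0) + seenAt endCode l 1 - 1) 0 *
    seenAt (fun s => codeAt (stepCode M j s.content) i) l 0

/-- The additional coordinates after the second block. -/
noncomputable def features₂ (M : TM B) (n T : ℕ) (l : List (Tok B N)) : Work B → ℤ
  | .table i => tableEntry M l i
  | w => features₁ n T l w

/-- The second block. It evaluates functions of the state and the scanned symbol, both being given
in one-hot form, as bilinear forms; only `B` neurons are needed for every such function. -/
noncomputable def block₂ (M : TM B) : IntBlock (Coord B (extraDim B)) where
  luA := 0
  luB := 0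
  gates := (Finset.univ : Finset (Fin B × Fin 5)).toList.map fun p =>
    ⟨Pi.single (wk (.oneHot p.1)) 1 + Pi.single (wk (.ended 1)) 1, -1,
      specialVec fun s => codeAt (stepCode M p.1 s.content) p.2, 0,
      Pi.single (wk (.table p.2)) 1⟩
  bias := 0

/-- The columns after the second block. -/
theorem features₂_eq (M : TM B) (n T : ℕ) (l : List (Tok B N)) (hl : l ≠ []) (i) :
    lastColumn (features₁ n T) l i + (0 : Coord B (extraDim B) → ℤ) i +
      (block₂ M).ffn (lastColumn (features₁ n T) l + 0) i =
      lastColumn (features₂ M n T) l i := by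
  obtain ⟨s, l, rfl⟩ := List.exists_cons_of_ne_nil hl
  simp only [IntBlock.ffn, block₂, List.map_map, Function.comp_def, Finset.sum_map_toList,
    Gate.value, lastColumn, add_zero, Pi.zero_apply, add_dotProduct, single_one_dotProduct,
    specialVec_dotProduct_column, column_wk]
  rw [Fintype.sum_prod_type]
  induction i using coord_cases with
  | h4 w =>
    simp only [column_wk, wk_inj, Pi.single_apply]
    cases w with
    | table i =>
      simp [features₂, features₁, memory₁, tableEntry, seenAt_cons_zero,
        seenAt_cons_succ, sub_eq_add_neg]
    | _ => simp [features₂]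
  | _ => simp [column, wk]

/-! ### The third block: the tokens to be generated -/

/-- The codes of a query with its delimiters. -/
def searchCode : List (Option (Special B)) :=
  some (.ctl .startSearch) :: queryCode ++ [some (.ctl .endSearch)]

/-- The part of the tokens after the result of a query that does not depend on the result. -/
def tailCode (B : ℕ) : List (Option (Special B)) := List.replicate 5 none ++ searchCode

/-- The codes of the tokens to be generated after the input. -/
def startCode (M : TM B) : List (Option (Special B)) :=
  some (moveSpecial true) :: some (.sym M.start) :: searchCode

/-- What the last token of a sequence causes to be generated `i` tokens later. -/
noncomputable def injection (M : TM B) (n : ℕ) (l : List (Tok B N)) (i : ℕ) : ℤ :=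
  (if i < 5 then tableEntry M l i else 0) + seenAt endCode l 1 * codeAt (tailCode B) i +
    (if (l.length : ℤ) = n + 1 then 1 else 0) * codeAt (startCode M) i

/-- The codes of the tokens to be generated after a sequence, as numbers. -/
noncomputable def pending (M : TM B) (n : ℕ) : List (Tok B N) → ℕ → ℤ
  | [], _ => 0
  | s :: l, i => pending M n l (i + 1) + injection M n (s :: l) i

theorem codeAt_of_length_le {L : List (Option (Special B))} {i : ℕ} (h : L.length ≤ i) :
    codeAt L i = 0 := by
  simp [codeAt, List.getElem?_eq_none h]

/-- The queue has length 36, the length of the longest list of tokens that is put into it. -/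
theorem pending_of_le (M : TM B) (n : ℕ) (l : List (Tok B N)) {i : ℕ} (hi : 36 ≤ i) :
    pending M n l i = 0 := by
  induction l generalizing i with
  | nil => rfl
  | cons s l ih =>
    rw [pending, ih (by omega), injection, if_neg (by omega),
      codeAt_of_length_le (by simp [tailCode, searchCode, queryCode]; omega),
      codeAt_of_length_le (by simp [startCode, searchCode, queryCode]; omega)]
    simp

/-- The state of the linear unit of the third block. -/
noncomputable def memory₃ (M : TM B) (n : ℕ) (l : List (Tok B N)) : Work B → ℤ
  | .chain i => pending M n l i
  | _ => 0

/-- The third block. Its linear unit is a queue of tokens to be generated, its feed-forward network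
turns the code `a` at the head of the queue into logits: the logit of a special token with code `j`
is `2 a j - j ^ 2`, and if `a = 0`, the logit of the number `j` is `2 k j - j ^ 2`, where `k` is
the label of the scanned cell. The last part of its neurons removes the input columns. -/
noncomputable def block₃ (M : TM B) : IntBlock (Coord B (extraDim B)) where
  luA := workVec fun
    | .chain i => if h : i.val + 1 < 36 then Pi.single (wk (.chain ⟨i + 1, h⟩)) 1 else 0
    | _ => 0
  luB := workVec fun
    | .chain i => (if h : i.val < 5 then Pi.single (wk (.table ⟨i, h⟩)) 1 else 0) +
        (Pi.single (wk (.ended 1)) (codeAt (tailCode B) i) +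
        Pi.single (wk .start) (codeAt (startCode M) i))
    | _ => 0
  gates :=
    [.linear (Pi.single (wk (.chain 0)) 2) (specialVec tokenCode),
      ⟨Pi.single (wk (.chain 0)) (-1), 1, Pi.single (wk .label) 2, 0, Pi.single .num 1⟩,
      .linear (Pi.single .num 1) (Pi.single .num (-1)),
      .linear (Pi.single .numSq 1) (Pi.single .numSq (-1))] ++
    (Finset.univ : Finset (Special B)).toList.map fun s =>
      .linear (Pi.single (.special s) 1) (Pi.single (.special s) (-1))
  bias := Pi.single .numSq (-1) + specialVec fun s => -tokenCode s ^ 2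

/-- The recursion of the third linear unit: every column shifts the queue by one place and adds the
tokens that it causes. -/
theorem memory₃_cons (M : TM B) (n T : ℕ) (s : Tok B N) (l : List (Tok B N)) (i) :
    workVec (memory₃ M n (s :: l)) i = (block₃ M).luA i ⬝ᵥ workVec (memory₃ M n l) +
      (block₃ M).luB i ⬝ᵥ lastColumn (features₂ M n T) (s :: l) := by
  rw [lastColumn]
  induction i using coord_cases with
  | h4 w =>
    simp only [block₃, workVec_wk]
    cases w with
    | chain i =>
      have h1 : (if h : i.val + 1 < 36 then (Pi.single (wk (.chain ⟨i + 1, h⟩)) 1 :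
          Coord B (extraDim B) → ℤ) else 0) ⬝ᵥ workVec (memory₃ M n l) =
          pending M n l (i + 1) := by
        split_ifs with h
        · simp [memory₃]
        · rw [pending_of_le _ _ _ (by omega)]
          simp
      have h2 : (if h : i.val < 5 then (Pi.single (wk (.table ⟨i, h⟩)) 1 :
          Coord B (extraDim B) → ℤ) else 0) ⬝ᵥ
          column s (l.length + 1) (features₂ M n T (s :: l)) =
          if i.val < 5 then tableEntry M (s :: l) i else 0 := by
        split_ifs with h <;> simp [features₂]
      simp only [add_dotProduct, h1, h2, single_dotProduct, column_wk]
      simp [memory₃, pending, injection, features₂, features₁, memory₁]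
      ring
    | _ => simp [memory₃]
  | _ => simp [block₃, workVec]

/-- The output of the network, in the coordinates that the word embeddings use. -/
theorem output_eq (M : TM B) (n T : ℕ) (l : List (Tok B N)) (hl : l ≠ []) :
    let y := fun i => lastColumn (features₂ M n T) l i + workVec (memory₃ M n l) i +
      (block₃ M).ffn (lastColumn (features₂ M n T) l + workVec (memory₃ M n l)) i
    y .num = 2 * (max (1 - pending M n l 0) 0 * cellLabel T (headPos l)) ∧ y .numSq = -1 ∧
    ∀ s, y (.special s) = 2 * pending M n l 0 * tokenCode s - tokenCode s ^ 2 := by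
  obtain ⟨s, l, rfl⟩ := List.exists_cons_of_ne_nil hl
  simp only [IntBlock.ffn, block₃, List.map_append, List.sum_append, List.map_map,
    Function.comp_def, Finset.sum_map_toList, List.map_cons, List.map_nil, List.sum_cons,
    List.sum_nil, Gate.value, single_dotProduct, lastColumn, Pi.add_apply]
  simp only [Gate.linear, workVec_wk, column_wk]
  refine ⟨?_, ?_, fun s' => ?_⟩
  · simp [workVec, column, specialVec, features₂, features₁, memory₁, memory₃]
    ring_nf
  · simp [workVec, column, specialVec]
  · have h1 : ∀ (l : ℤ) (f : Work B → ℤ) (s' : Special B),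
        column s l f (.special s') = if s = .spec s' then 1 else 0 := fun _ _ _ => rfl
    have h2 : ∀ (f : Work B → ℤ) (s' : Special B), workVec f (.special s') = 0 := fun _ _ => rfl
    simp only [Pi.single_apply, h1, h2, add_zero, Coord.special.injEq, reduceCtorEq, if_false,
      ite_mul, zero_mul, specialVec, zero_add, one_mul, neg_mul]
    rw [Finset.sum_ite_eq]
    simp [features₂, features₁, memory₁, memory₃, h1, h2]
    ring

end RagRNN

namespace RagRNN

/-! ### The network and bounds for its numbers -/

variable {B N : ℕ}

theorem card_special_le (B : ℕ) : Fintype.card (Special B) ≤ B + 24 := by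
  let f : Special B → Fin B ⊕ Ctl ⊕ RxChar := fun
    | .sym i => .inl i
    | .ctl c => .inr (.inl c)
    | .rx c => .inr (.inr c)
  have hf : Function.Injective f := by
    intro s s' h
    cases s <;> cases s' <;> simp_all [f]
  have h1 : Fintype.card Ctl = 7 := rfl
  have h2 : Fintype.card RxChar = 17 := rfl
  simpa [h1, h2] using Fintype.card_le_of_injective f hf

theorem extraDim_le (B : ℕ) : extraDim B ≤ B + 79 := by
  let f : Work B → Fin B ⊕ Fin 33 ⊕ Fin 2 ⊕ Fin 5 ⊕ Fin 36 ⊕ Fin 3 := fun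
    | .oneHot i => .inl i
    | .delay i => .inr (.inl i)
    | .ended i => .inr (.inr (.inl i))
    | .table i => .inr (.inr (.inr (.inl i)))
    | .chain i => .inr (.inr (.inr (.inr (.inl i))))
    | .head => .inr (.inr (.inr (.inr (.inr 0))))
    | .start => .inr (.inr (.inr (.inr (.inr 1))))
    | .label => .inr (.inr (.inr (.inr (.inr 2))))
  have hf : Function.Injective f := by
    intro s s' h
    cases s <;> cases s' <;> simp_all [f]
  simpa using Fintype.card_le_of_injective f hf

theorem card_coord_le (B : ℕ) : Fintype.card (Coord B (extraDim B)) ≤ 2 * B + 106 := by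
  let f : Coord B (extraDim B) → Special B ⊕ Fin (extraDim B) ⊕ Fin 3 := fun
    | .special s => .inl s
    | .work j => .inr (.inl j)
    | .num => .inr (.inr 0)
    | .numSq => .inr (.inr 1)
    | .pos => .inr (.inr 2)
  have hf : Function.Injective f := by
    intro s s' h
    cases s <;> cases s' <;> simp_all [f]
  have h := Fintype.card_le_of_injective f hf
  have h1 := card_special_le B
  have h2 := extraDim_le B
  simp only [Fintype.card_sum, Fintype.card_fin] at h
  omega

/-- The common width of the feed-forward networks. -/
abbrev ffnWidth (B : ℕ) : ℕ := 5 * B + 28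

/-- The network that simulates the machine `M` on inputs of length `n` for `T` steps. -/
noncomputable abbrev network (M : TM B) (n T q : ℕ) : LinearRNN B where
  N := 2 * T + 2
  half := q
  extra := extraDim B
  width := ffnWidth B
  layers := [(block₁ B n T).toBlock (ffnWidth B), (block₂ M).toBlock (ffnWidth B),
    (block₃ M).toBlock (ffnWidth B)]

theorem length_gates₁ (B n T : ℕ) : (block₁ B n T).gates.length ≤ ffnWidth B := by
  simp [block₁, eqGates]
  omega

theorem length_gates₂ (M : TM B) : (block₂ M).gates.length ≤ ffnWidth B := by
  simp [block₂, ffnWidth]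
  omega

theorem length_gates₃ (M : TM B) : (block₃ M).gates.length ≤ ffnWidth B := by
  have := card_special_le B
  simp [block₃]
  omega

/-- A bound for the weights, the dimensions and the length of a chain of thought. All numbers in the
network are bounded by powers of it. -/
def scale (B T : ℕ) : ℤ := (B + 200) ^ 2 * (T + 2)

section Bounds

variable (B T : ℕ)

theorem scale_ge : 2 * (B : ℤ) ^ 2 + 800 * B + 80000 ≤ scale B T ∧
    40000 * ((T : ℤ) + 2) ≤ scale B T := by
  have hB : (0 : ℤ) ≤ B := by positivity
  have hT : (0 : ℤ) ≤ T := by positivity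
  constructor
  · calc 2 * (B : ℤ) ^ 2 + 800 * B + 80000 = ((B : ℤ) + 200) ^ 2 * 2 := by ring
      _ ≤ scale B T := mul_le_mul_of_nonneg_left (by linarith) (by positivity)
  · exact mul_le_mul_of_nonneg_right (by nlinarith) (by positivity)

theorem abs_tokenCode_le (s : Special B) : 1 ≤ tokenCode s ∧ tokenCode s ≤ B + 24 := by
  have h1 := (Fintype.equivFin (Special B) s).isLt
  have h2 := card_special_le B
  simp only [tokenCode]
  omega

theorem abs_codeAt_le (L : List (Option (Special B))) (i : ℕ) : |codeAt L i| ≤ B + 24 := by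
  rw [codeAt]
  rcases (L[i]?).getD none with _ | s
  · simp; positivity
  · have := abs_tokenCode_le B s
    exact abs_le.2 ⟨by simp; linarith, this.2⟩

theorem abs_single_le {ι : Type} [DecidableEq ι] {v Z : ℤ} (hv : |v| ≤ Z) (i j : ι) :
    |(Pi.single i v : ι → ℤ) j| ≤ Z := by
  rw [Pi.single_apply]
  split_ifs
  · exact hv
  · simpa using (abs_nonneg v).trans hv

variable {B}

theorem abs_specialVec_le {g : Special B → ℤ} {Z : ℤ} (hZ : 0 ≤ Z) (hg : ∀ s, |g s| ≤ Z) (i) :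
    |specialVec g i| ≤ Z := by
  cases i <;> simp [specialVec, hg, hZ]

theorem abs_workVec_le {f : Work B → ℤ} {Z : ℤ} (hZ : 0 ≤ Z) (hf : ∀ w, |f w| ≤ Z) (i) :
    |workVec f i| ≤ Z := by
  cases i <;> simp [workVec, hf, hZ]

theorem abs_workVec_apply_le {f : Work B → Coord B (extraDim B) → ℤ} {Z : ℤ} (hZ : 0 ≤ Z)
    (hf : ∀ w j, |f w j| ≤ Z) (i j) : |workVec f i j| ≤ Z := by
  cases i <;> simp [workVec, hf, hZ]

theorem abs_stateCode_le (s : Special B) : |stateCode s| ≤ B := by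
  rcases s with i | c | c
  · have := i.isLt
    simp only [stateCode]
    rw [abs_le]
    omega
  · simp [stateCode]
  · simp [stateCode]

theorem abs_endCode_le (s : Special B) : |endCode s| ≤ 1 := by
  rw [endCode]; split_ifs <;> simp

theorem abs_moveCode_le (s : Special B) : |moveCode s| ≤ 1 := by
  unfold moveCode
  split <;> simp

theorem weightsLE_block₁ {n : ℕ} (hn : n ≤ T) : (block₁ B n T).WeightsLE (scale B T) := by
  obtain ⟨h1, h2⟩ := scale_ge B T
  have hB : (0 : ℤ) ≤ B := by positivity
  have hB2 : (0 : ℤ) ≤ (B : ℤ) ^ 2 := by positivity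
  have hT : (0 : ℤ) ≤ T := by positivity
  have hn' : (n : ℤ) ≤ T := by exact_mod_cast hn
  have hn0 : (0 : ℤ) ≤ n := by positivity
  have hZ0 : 0 ≤ scale B T := by linarith
  have heq : ∀ (a : Coord B (extraDim B)) (v : ℤ) (c), |v| ≤ B + T + 1 →
      ∀ g ∈ eqGates (Pi.single a 1) v c, (∀ i, |g.w₁ i| ≤ scale B T) ∧ |g.b₁| ≤ scale B T ∧
        (∀ i, |g.w₂ i| ≤ scale B T) ∧ |g.b₂| ≤ scale B T ∧ ∀ i, |g.out i| ≤ scale B T := by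
    intro a v c hv g hg
    obtain ⟨hv1, hv2⟩ := abs_le.1 hv
    simp only [eqGates, List.mem_cons, List.not_mem_nil, or_false] at hg
    rcases hg with rfl | rfl | rfl <;>
    refine ⟨abs_single_le (by rw [abs_one]; linarith) a, ?_, fun i => ?_, ?_,
      abs_single_le ?_ c⟩ <;>
    simp only [Gate.relu, Pi.zero_apply, abs_zero, abs_one, abs_neg, abs_two] <;>
    first
      | linarith
      | (rw [abs_le]; constructor <;> linarith)
  refine ⟨fun i j => ?_, fun i j => ?_, fun g hg => ?_, fun i => ?_⟩
  · simp only [block₁]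
    refine abs_workVec_apply_le hZ0 (fun w j => ?_) i j
    have key : ∀ v : Work B, |(Pi.single (wk v) 1 : Coord B (extraDim B) → ℤ) j| ≤ scale B T :=
      fun v => abs_single_le (by rw [abs_one]; linarith) _ _
    cases w with
    | delay i =>
      simp only
      split_ifs
      · exact key _
      · simpa using hZ0
    | ended i =>
      simp only
      split_ifs
      · exact key _
      · simpa using hZ0
    | head => exact key _
    | _ => simpa using hZ0
  · simp only [block₁]
    refine abs_workVec_apply_le hZ0 (fun w j => ?_) i j
    have key : ∀ g : Special B → ℤ, (∀ s, |g s| ≤ B + 1) → |specialVec g j| ≤ scale B T :=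
      fun g hg => abs_specialVec_le (by linarith) (fun s => (hg s).trans (by linarith)) j
    cases w with
    | delay i =>
      simp only
      split_ifs
      · exact key _ fun s => (abs_stateCode_le s).trans (by linarith)
      · simpa using hZ0
    | ended i =>
      simp only
      split_ifs
      · exact key _ fun s => (abs_endCode_le s).trans (by linarith)
      · simpa using hZ0
    | head => exact key _ fun s => (abs_moveCode_le s).trans (by linarith)
    | _ => simpa using hZ0
  · simp only [block₁, List.mem_append, List.mem_flatMap, List.mem_cons, List.not_mem_nil,
      or_false] at hg
    rcases hg with (⟨j, -, hg⟩ | hg) | hg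
    · have hj := j.isLt
      exact heq _ _ _ (by rw [abs_le]; omega) g hg
    · exact heq _ _ _ (by rw [abs_le]; omega) g hg
    · rcases hg with rfl | rfl | rfl <;>
      refine ⟨abs_single_le ?_ _, ?_, fun i => ?_, ?_, abs_single_le ?_ _⟩ <;>
      (try simp only [Gate.relu, Pi.zero_apply, abs_zero, abs_one, abs_neg]) <;>
      first
        | linarith
        | (rw [abs_le]; constructor <;> linarith)
  · simp [block₁]; linarith

theorem weightsLE_block₂ (M : TM B) : (block₂ M).WeightsLE (scale B T) := by
  obtain ⟨h1, h2⟩ := scale_ge B T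
  have hB : (0 : ℤ) ≤ B := by positivity
  have hB2 : (0 : ℤ) ≤ (B : ℤ) ^ 2 := by positivity
  refine ⟨fun i j => ?_, fun i j => ?_, fun g hg => ?_, fun i => ?_⟩
  · simp [block₂]; linarith
  · simp [block₂]; linarith
  · simp only [block₂, List.mem_map] at hg
    obtain ⟨p, -, rfl⟩ := hg
    refine ⟨fun i => ?_, by simp; linarith, abs_specialVec_le (by linarith) fun s =>
      (abs_codeAt_le B _ _).trans (by linarith), by simp; linarith,
      abs_single_le (by simp; linarith) _⟩
    refine (abs_add_le _ _).trans ?_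
    have k1 : |(Pi.single (wk (.oneHot p.1)) 1 : Coord B (extraDim B) → ℤ) i| ≤ 1 :=
      abs_single_le (by simp) _ _
    have k2 : |(Pi.single (wk (.ended 1)) 1 : Coord B (extraDim B) → ℤ) i| ≤ 1 :=
      abs_single_le (by simp) _ _
    linarith
  · simp [block₂]; linarith

theorem weightsLE_block₃ (M : TM B) : (block₃ M).WeightsLE (scale B T) := by
  obtain ⟨h1, h2⟩ := scale_ge B T
  have hB : (0 : ℤ) ≤ B := by positivity
  have hB2 : (0 : ℤ) ≤ (B : ℤ) ^ 2 := by positivity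
  have hZ : 0 ≤ scale B T := by linarith
  have hcode : ∀ (s : Special B), |tokenCode s| ≤ B + 24 := fun s => by
    obtain ⟨k1, k2⟩ := abs_tokenCode_le B s
    rw [abs_le]; constructor <;> linarith
  have hsingle : ∀ (c : Coord B (extraDim B)) (v : ℤ), |v| ≤ B + 24 → ∀ i,
      |(Pi.single c v : Coord B (extraDim B) → ℤ) i| ≤ B + 24 := fun c v hv i =>
    abs_single_le hv _ _
  have hlin : ∀ (c : Coord B (extraDim B)), ∀ g, g = Gate.linear (Pi.single c 1)
      (Pi.single c (-1)) → (∀ i, |g.w₁ i| ≤ scale B T) ∧ |g.b₁| ≤ scale B T ∧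
        (∀ i, |g.w₂ i| ≤ scale B T) ∧ |g.b₂| ≤ scale B T ∧ ∀ i, |g.out i| ≤ scale B T := by
    rintro c g rfl
    refine ⟨fun i => ?_, ?_, fun i => ?_, ?_, fun i => ?_⟩
    · simpa [Gate.linear] using hZ
    · simp [Gate.linear]; linarith
    · exact (hsingle c 1 (by simp; linarith) i).trans (by linarith)
    · simpa [Gate.linear] using hZ
    · exact (hsingle c (-1) (by simp; linarith) i).trans (by linarith)
  refine ⟨fun i j => ?_, fun i j => ?_, fun g hg => ?_, fun i => ?_⟩
  · simp only [block₃]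
    refine abs_workVec_apply_le hZ (fun w j => ?_) i j
    cases w <;> simp only <;> first | (simpa using hZ) | skip
    split_ifs
    · exact (hsingle _ 1 (by simp; linarith) j).trans (by linarith)
    · simpa using hZ
  · simp only [block₃]
    refine abs_workVec_apply_le hZ (fun w j => ?_) i j
    cases w <;> simp only <;> first | (simpa using hZ) | skip
    rename_i i
    refine (abs_add_le _ _).trans ((add_le_add (b := (B : ℤ) + 24) ?_ (abs_add_le _ _)).trans ?_)
    · split_ifs
      · exact hsingle _ 1 (by simp; linarith) j
      · simp; linarith
    · have k1 := hsingle (wk (.ended 1)) _ (abs_codeAt_le B (tailCode B) i) j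
      have k2 := hsingle (wk .start) _ (abs_codeAt_le B (startCode M) i) j
      linarith
  · simp only [block₃, List.mem_append, List.mem_map, List.mem_cons, List.not_mem_nil,
      or_false] at hg
    rcases hg with (rfl | rfl | hg | hg) | ⟨s, -, hg⟩
    · refine ⟨fun i => ?_, ?_, fun i => ?_, ?_, abs_specialVec_le hZ fun s =>
        (hcode s).trans (by linarith)⟩
      · simpa [Gate.linear] using hZ
      · simp [Gate.linear]; linarith
      · exact (hsingle _ 2 (by simp; linarith) i).trans (by linarith)
      · simpa [Gate.linear] using hZ
    · refine ⟨fun i => ?_, ?_, fun i => ?_, ?_, fun i => ?_⟩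
      · exact (hsingle _ (-1) (by simp; linarith) i).trans (by linarith)
      · simp; linarith
      · exact (hsingle _ 2 (by simp; linarith) i).trans (by linarith)
      · simpa using hZ
      · exact (hsingle _ 1 (by simp; linarith) i).trans (by linarith)
    · exact hlin _ g hg
    · exact hlin _ g hg
    · exact hlin _ g hg.symm
  · refine (abs_add_le _ _).trans ((add_le_add (hsingle .numSq (-1) (by simp; linarith) i)
      (abs_specialVec_le (Z := (B + 24) ^ 2) (by positivity) (fun s => ?_) i)).trans ?_)
    · rw [abs_neg, abs_pow]
      exact pow_le_pow_left₀ (abs_nonneg _) (hcode s) 2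
    · nlinarith

theorem abs_seenAt_le {g : Special B → ℤ} {Z : ℤ} (hZ : 0 ≤ Z) (hg : ∀ s, |g s| ≤ Z)
    (l : List (Tok B N)) (i : ℕ) : |seenAt g l i| ≤ Z := by
  rw [seenAt]
  rcases l[i]? with _ | (k | s)
  · simpa using hZ
  · simpa [Tok.extend] using hZ
  · exact hg s

theorem abs_headPos_le (l : List (Tok B N)) : |headPos l| ≤ l.length := by
  refine (abs_list_sum_le l _ (Y := 1) fun s _ => ?_).trans_eq (mul_one _)
  cases s with
  | num k => simp [Tok.extend]
  | spec s => exact abs_moveCode_le s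

theorem abs_memory₁_le (l : List (Tok B N)) (i) : |workVec (memory₁ l) i| ≤ B + 1 + l.length := by
  refine abs_workVec_le (by positivity) (fun w => ?_) i
  have hB : (0 : ℤ) ≤ B := by positivity
  have hl : (0 : ℤ) ≤ l.length := by positivity
  cases w with
  | delay i => exact (abs_seenAt_le hB abs_stateCode_le l i).trans (by linarith)
  | ended i => exact (abs_seenAt_le zero_le_one abs_endCode_le l i).trans (by linarith)
  | head => exact (abs_headPos_le l).trans (by linarith)
  | _ => simp [memory₁]; linarith

theorem abs_lastColumn_le (l : List (Tok B N)) (i) :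
    |lastColumn (fun _ => 0) l i| ≤ ((N : ℤ) + 1) ^ 2 + l.length := by
  cases l with
  | nil => simp [lastColumn]; positivity
  | cons s l =>
    have hl : (0 : ℤ) ≤ l.length := by positivity
    have h1 : 0 ≤ s.number ∧ s.number ≤ N := by
      cases s with
      | num k => have := k.isLt; simp only [Tok.number]; omega
      | spec s => simp [Tok.number]
    have h2 : ((1 : ℤ)) ≤ (N + 1) ^ 2 := one_le_pow₀ (by linarith [h1.1, h1.2])
    rw [List.length_cons]
    push_cast
    cases i <;> simp only [lastColumn, column]
    · rw [abs_of_nonneg h1.1]; nlinarith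
    · rw [abs_of_nonneg (by positivity)]; nlinarith
    · split_ifs <;> simp <;> linarith
    · simp; positivity
    · rw [abs_of_nonneg (by positivity)]; nlinarith

theorem abs_injection_le (M : TM B) (n : ℕ) (l : List (Tok B N)) (i : ℕ) :
    |injection M n l i| ≤ (B + 24) * (B + 2) := by
  have hB : (0 : ℤ) ≤ B := by positivity
  have ht : |tableEntry M l i| ≤ B * (B + 24) := by
    have key : ∀ j ∈ (Finset.univ : Finset (Fin B)),
        |max ((if seenAt stateCode l 32 = j + 1 then 1 else 0) + seenAt endCode l 1 - 1) 0 *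
          seenAt (fun s => codeAt (stepCode M j s.content) i) l 0| ≤ (B : ℤ) + 24 := by
      intro j _
      have h1 := abs_le.1 (abs_seenAt_le zero_le_one abs_endCode_le l 1)
      have h2 := abs_seenAt_le (g := fun s => codeAt (stepCode M j s.content) i)
        (by positivity) (fun s => abs_codeAt_le B _ _) l 0
      rw [abs_mul]
      refine (mul_le_mul (b := 1) ?_ h2 (abs_nonneg _) zero_le_one).trans_eq (one_mul _)
      rw [abs_of_nonneg (le_max_right _ _)]
      refine max_le ?_ zero_le_one
      split_ifs <;> linarith [h1.1, h1.2]
    refine (Finset.abs_sum_le_sum_abs _ _).trans ((Finset.sum_le_sum key).trans_eq ?_)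
    simp
  have h1 : |if i < 5 then tableEntry M l i else 0| ≤ B * (B + 24) := by
    split_ifs
    · exact ht
    · simp; positivity
  have h2 : |seenAt endCode l 1 * codeAt (tailCode B) i| ≤ B + 24 := by
    rw [abs_mul]
    exact (mul_le_mul (abs_seenAt_le zero_le_one abs_endCode_le l 1) (abs_codeAt_le B _ _)
      (abs_nonneg _) zero_le_one).trans_eq (one_mul _)
  have h3 : |(if (l.length : ℤ) = n + 1 then 1 else 0) * codeAt (startCode M) i| ≤ B + 24 := by
    have := abs_codeAt_le B (startCode M) i
    split_ifs
    · simpa using this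
    · simp; positivity
  rw [injection]
  refine (abs_add_le _ _).trans ((add_le_add (abs_add_le _ _) h3).trans ?_)
  linarith

/-- The queue does not accumulate: what is injected leaves it after 36 tokens. -/
theorem abs_pending_le (M : TM B) (n : ℕ) (l : List (Tok B N)) (i : ℕ) :
    |pending M n l i| ≤ ((36 - i : ℕ) : ℤ) * ((B + 24) * (B + 2)) := by
  induction l generalizing i with
  | nil => simp [pending]; positivity
  | cons s l ih =>
    by_cases hi : 36 ≤ i
    · rw [pending_of_le _ _ _ hi]; simp; positivity
    · have h1 : ((36 - i : ℕ) : ℤ) = ((36 - (i + 1) : ℕ) : ℤ) + 1 := by omega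
      rw [pending, h1, add_mul, one_mul]
      exact (abs_add_le _ _).trans (add_le_add (ih _) (abs_injection_le M n _ i))

theorem abs_memory₃_le (M : TM B) (n : ℕ) (l : List (Tok B N)) (i) :
    |workVec (memory₃ M n l) i| ≤ 36 * ((B + 24) * (B + 2)) := by
  refine abs_workVec_le (by positivity) (fun w => ?_) i
  cases w with
  | chain i =>
    refine (abs_pending_le M n l i).trans (mul_le_mul_of_nonneg_right ?_ (by positivity))
    omega
  | _ => simp [memory₃]; positivity

end Bounds

end RagRNN

namespace RagRNN

/-! ### The next token -/

variable {B : ℕ}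

section Output

variable (M : TM B) {n T q : ℕ} (S : List (Tok B (2 * T + 2)))

theorem wordEmb_eq_column {N : ℕ} (s : Tok B N) (i) :
    wordEmb (extraDim B) s i = ((column s 0 0 i : ℤ) : ℝ) := by
  cases s <;> cases i <;> simp [wordEmb, column, Tok.number, eq_comm]

theorem column_eq_add {N : ℕ} (s : Tok B N) (l : ℤ) (i) :
    column s l 0 i =
      column s 0 0 i + (Pi.single .pos l : Coord B (extraDim B) → ℤ) i := by
  cases i <;> simp [column]

theorem abs_embedding_le {a : ℕ} (ha : 2 ≤ a) (hlen : S.length ≤ 100 * (T + 2))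
    (l : List (Tok B (2 * T + 2))) (hl : l.length ≤ S.length) (i) :
    |lastColumn (fun _ => 0) l i| ≤ scale B T ^ a ∧ |workVec (memory₁ l) i| ≤ scale B T ^ a ∧
    |workVec (memory₃ M n l) i| ≤ scale B T ^ a := by
  obtain ⟨h1, h2⟩ := scale_ge B T
  have hB : (0 : ℤ) ≤ B := by positivity
  have hT : (0 : ℤ) ≤ T := by positivity
  have hl' : (l.length : ℤ) ≤ 100 * (T + 2) := by exact_mod_cast hl.trans hlen
  have hl0 : (0 : ℤ) ≤ l.length := by positivity
  have hpow : scale B T ^ 2 ≤ scale B T ^ a := pow_le_pow_right₀ (by nlinarith) ha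
  have hge : 40000 * ((T : ℤ) + 2) * (40000 * ((T : ℤ) + 2)) ≤ scale B T ^ 2 := by
    rw [sq]; exact mul_le_mul h2 h2 (by positivity) (by linarith)
  have hge' : (80000 : ℤ) * scale B T ≤ scale B T ^ 2 := by
    rw [sq]; exact mul_le_mul_of_nonneg_right (by nlinarith) (by nlinarith)
  refine ⟨(abs_lastColumn_le l i).trans (le_trans ?_ hpow),
    (abs_memory₁_le l i).trans (le_trans ?_ hpow),
    (abs_memory₃_le M n l i).trans (le_trans ?_ hpow)⟩
  · push_cast; nlinarith
  · nlinarith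
  · nlinarith

theorem embed_network (hlen : S.length ≤ 100 * (T + 2))
    (hq : scale B T ^ 103 < 2 ^ q) (t : ℕ) (ht : t < S.length) (i) :
    (network M n T q).embed S t i =
      ((lastColumn (fun _ => 0) (S.take (t + 1)).reverse i : ℤ) : ℝ) := by
  obtain ⟨h1, h2⟩ := scale_ge B T
  have hb := (abs_embedding_le M (n := n) S (a := 2) le_rfl hlen (S.take (t + 1)).reverse
    (by simp) i).1
  have hpow : scale B T ^ 2 < 2 ^ q :=
    lt_of_le_of_lt (pow_le_pow_right₀ (by nlinarith) (by norm_num)) hq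
  rw [← rnd_intCast (lt_of_le_of_lt hb hpow)]
  have he : (S.take (t + 1)).reverse = S[t] :: (S.take t).reverse := by
    rw [List.take_succ_eq_append_getElem ht, List.reverse_append]
    rfl
  rw [he, lastColumn, column_eq_add, LinearRNN.embed, List.getElem?_eq_getElem ht]
  simp only [rndVec]
  congr 1
  rw [Pi.add_apply, wordEmb_eq_column, List.length_reverse, List.length_take,
    min_eq_left ht.le]
  push_cast
  congr 1
  cases i <;> simp [posEmb]

/-- The three blocks applied to the embedded sequence. The exponents come from the bound
`Z ^ a ↦ Z ^ (2 * a + 12)` for one block: `2 ↦ 16 ↦ 44 ↦ 100`. -/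
theorem output_network (hn : n ≤ T) (hS : S ≠ []) (hlen : S.length ≤ 100 * (T + 2))
    (hq : scale B T ^ 103 < 2 ^ q) :
    ∃ y : Coord B (extraDim B) → ℤ, (∀ i, (network M n T q).output S i = y i) ∧
      (∀ i, |y i| ≤ scale B T ^ 100) ∧
      y .num = 2 * (max (1 - pending M n S.reverse 0) 0 * cellLabel T (headPos S.reverse)) ∧
      y .numSq = -1 ∧
      ∀ s, y (.special s) =
        2 * pending M n S.reverse 0 * tokenCode s - tokenCode s ^ 2 := by
  obtain ⟨h1, h2⟩ := scale_ge B T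
  have hB : (0 : ℤ) ≤ B := by positivity
  have hB2 : (0 : ℤ) ≤ (B : ℤ) ^ 2 := by positivity
  have hZ : 2 ≤ scale B T := by linarith
  have hcard : (Fintype.card (Coord B (extraDim B)) : ℤ) ≤ scale B T := by
    have : (Fintype.card (Coord B (extraDim B)) : ℤ) ≤ 2 * B + 106 := by
      exact_mod_cast card_coord_le B
    linarith
  have hgates : ∀ F : IntBlock (Coord B (extraDim B)), F.gates.length ≤ ffnWidth B →
      (F.gates.length : ℤ) ≤ scale B T := by
    intro F hF
    have : (F.gates.length : ℤ) ≤ 5 * B + 28 := by exact_mod_cast hF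
    linarith
  have hpow : ∀ {e : ℕ}, e ≤ 103 → scale B T ^ e < 2 ^ q := fun he =>
    lt_of_le_of_lt (pow_le_pow_right₀ (by linarith) he) hq
  have w1 := weightsLE_block₁ (B := B) T hn
  have w2 := weightsLE_block₂ T M
  have w3 := weightsLE_block₃ T M
  have l1 := length_gates₁ B n T
  have l2 := length_gates₂ M
  have l3 := length_gates₃ M
  have hb := fun (a : ℕ) (ha : 2 ≤ a) => abs_embedding_le M (n := n) S ha hlen
  have b1 : ∀ l : List (Tok B (2 * T + 2)), l ≠ [] → l.length ≤ S.length → ∀ i,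
      |lastColumn (features₁ n T) l i| ≤ scale B T ^ 16 := by
    intro l hl hl' i
    rw [← features₁_eq n T l hl]
    exact (IntBlock.abs_layer_le w1 hcard (hgates _ l1) hZ (fun i => (hb 2 le_rfl l hl' i).1)
      (fun i => (hb 2 le_rfl l hl' i).2.1) i).2
  have b2 : ∀ l : List (Tok B (2 * T + 2)), l ≠ [] → l.length ≤ S.length → ∀ i,
      |lastColumn (features₂ M n T) l i| ≤ scale B T ^ 44 := by
    intro l hl hl' i
    rw [← features₂_eq M n T l hl]
    exact (IntBlock.abs_layer_le w2 hcard (hgates _ l2) hZ (b1 l hl hl')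
      (fun i => by simp; positivity) i).2
  have hne : ∀ t < S.length, (S.take (t + 1)).reverse ≠ [] := by
    intro t ht h
    rw [List.reverse_eq_nil_iff, List.take_eq_nil_iff] at h
    rcases h with h | h
    · omega
    · exact hS h
  have c1 : ∀ t < S.length, ∀ i, ((block₁ B n T).toBlock (ffnWidth B)).apply q
      ((network M n T q).embed S) t i =
        ((lastColumn (features₁ n T) (S.take (t + 1)).reverse i : ℤ) : ℝ) := by
    intro t ht i
    rw [IntBlock.apply_toBlock_of_reverse w1 hcard (hgates _ l1) hZ (a := 2) l1 (hpow (by norm_num))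
      S (C := lastColumn fun _ => 0) (H := fun l => workVec (memory₁ l))
      (embed_network M S hlen hq) ?_ (fun s l i => memory₁_cons n T s l i)
      (fun l _ hl i => (hb 2 le_rfl l hl i).1) (fun l hl i => (hb 2 le_rfl l hl i).2.1) t ht i,
      features₁_eq n T _ (hne t ht)]
    funext i
    induction i using coord_cases with
    | h4 w => cases w <;> simp [memory₁, seenAt_nil, headPos]
    | _ => rfl
  have c2 : ∀ t < S.length, ∀ i, ((block₂ M).toBlock (ffnWidth B)).apply q
      (((block₁ B n T).toBlock (ffnWidth B)).apply q ((network M n T q).embed S)) t i =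
        ((lastColumn (features₂ M n T) (S.take (t + 1)).reverse i : ℤ) : ℝ) := by
    intro t ht i
    rw [IntBlock.apply_toBlock_of_reverse w2 hcard (hgates _ l2) hZ (a := 16) l2
      (hpow (by norm_num)) S (C := lastColumn (features₁ n T)) (H := fun l => 0)
      c1 rfl (fun s l i => by simp [block₂]) b1 (fun l hl i => by simp; positivity) t ht i]
    rw [features₂_eq M n T _ (hne t ht)]
  have hpos : 0 < S.length := List.length_pos_iff.2 hS
  have hS1 : (S.take (S.length - 1 + 1)).reverse = S.reverse := by
    rw [Nat.sub_add_cancel hpos, List.take_length]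
  obtain ⟨o1, o2, o3⟩ := output_eq M n T S.reverse (by simpa using hS)
  refine ⟨fun i => lastColumn (features₂ M n T) S.reverse i +
    workVec (memory₃ M n S.reverse) i + (block₃ M).ffn (lastColumn (features₂ M n T) S.reverse +
      workVec (memory₃ M n S.reverse)) i, fun i => ?_, fun i => ?_, o1, o2, o3⟩
  · have := IntBlock.apply_toBlock_of_reverse w3 hcard (hgates _ l3) hZ (a := 44) l3
      (hpow (by norm_num)) S (C := lastColumn (features₂ M n T))
      (H := fun l => workVec (memory₃ M n l)) c2 ?_ (fun s l i => memory₃_cons M n T s l i) b2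
      (fun l hl i => (hb 44 (by norm_num) l hl i).2.2) (S.length - 1) (by omega) i
    · rw [hS1] at this
      rw [← this]
      rfl
    · funext i
      induction i using coord_cases with
      | h4 w => cases w <;> simp [memory₃, pending]
      | _ => rfl
  · exact (IntBlock.abs_layer_le w3 hcard (hgates _ l3) hZ (b2 S.reverse (by simpa using hS)
      (by simp)) (fun i => (hb 44 (by norm_num) S.reverse (by simp) i).2.2) i).2

/-- The logit of a token, if `a` is the code of the token to be generated, or if `a = 0` and the
number `m` is to be generated. -/
noncomputable def score {N : ℕ} (a m : ℤ) : Tok B N → ℤ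
  | .num k => 2 * m * (k + 1) - (k + 1) ^ 2
  | .spec s => 2 * a * tokenCode s - tokenCode s ^ 2

/-- The logits are exact: a word embedding is at most `Z ^ 2`, the output at most `Z ^ 100`, and the
dimension at most `Z`, which makes `Z ^ 103`. -/
theorem logit_network (hn : n ≤ T) (hS : S ≠ []) (hlen : S.length ≤ 100 * (T + 2))
    (hq : scale B T ^ 103 < 2 ^ q) (s : Tok B (2 * T + 2)) :
    (network M n T q).logit S s = ((score (pending M n S.reverse 0)
      (max (1 - pending M n S.reverse 0) 0 * cellLabel T (headPos S.reverse)) s : ℤ) : ℝ) := by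
  obtain ⟨h1, h2⟩ := scale_ge B T
  have hZ : 2 ≤ scale B T := by nlinarith
  obtain ⟨y, hy, hyb, y1, y2, y3⟩ := output_network M S hn hS hlen hq
  have hcol : ∀ i, |column s 0 0 i| ≤ scale B T ^ 2 := by
    intro i
    have := (abs_embedding_le M (n := n) S le_rfl hlen [s] (List.length_pos_iff.2 hS) i).1
    cases i with
    | pos => simp [column]; positivity
    | _ => exact this
  have hround : ∀ i, rnd q (wordEmb (extraDim B) s i) = ((column s 0 0 i : ℤ) : ℝ) := by
    intro i
    rw [wordEmb_eq_column]
    exact rnd_intCast (lt_of_le_of_lt ((hcol i).trans (pow_le_pow_right₀ (by linarith)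
      (by norm_num : 2 ≤ 103))) hq)
  have hdot : column s 0 0 ⬝ᵥ y = score (pending M n S.reverse 0)
      (max (1 - pending M n S.reverse 0) 0 * cellLabel T (headPos S.reverse)) s := by
    cases s with
    | num k =>
      have : column (.num k : Tok B (2 * T + 2)) 0 0 =
          Pi.single .num ((k : ℤ) + 1) + Pi.single .numSq (((k : ℤ) + 1) ^ 2) := by
        funext i
        cases i <;> simp [column, Tok.number]
      rw [this, add_dotProduct, single_dotProduct, single_dotProduct, y1, y2, score]
      ring
    | spec s =>
      have : column (.spec s : Tok B (2 * T + 2)) 0 0 = Pi.single (.special s) 1 := by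
        funext i
        cases i <;> simp [column, Pi.single_apply, Tok.number, eq_comm]
      rw [this, single_one_dotProduct, y3, score]
  have hbound : |column s 0 0 ⬝ᵥ y| ≤ scale B T ^ 103 := by
    have hcard : (Fintype.card (Coord B (extraDim B)) : ℤ) ≤ scale B T := by
      have : (Fintype.card (Coord B (extraDim B)) : ℤ) ≤ 2 * B + 106 := by
        exact_mod_cast card_coord_le B
      nlinarith
    refine (abs_dotProduct_le (by positivity) hcol hyb).trans
      ((mul_le_mul_of_nonneg_right hcard (by positivity)).trans_eq (by ring))
  rw [← hdot, ← rnd_intCast (lt_of_le_of_lt hbound hq), LinearRNN.logit, ← cast_dotProduct]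
  congr 1
  exact Finset.sum_congr rfl fun i _ => by rw [← hround, ← hy]

/-- The parabola `2 a j - j ^ 2` has its maximum at `j = a`, and all scores of numbers are
negative. -/
theorem score_lt_special {N : ℕ} (s : Special B) {s' : Tok B N} (hs : s' ≠ .spec s) :
    score (tokenCode s) 0 s' < score (tokenCode s) 0 (.spec s : Tok B N) := by
  have h1 := (abs_tokenCode_le B s).1
  cases s' with
  | num k => simp only [score]; nlinarith
  | spec s' =>
    have hne : tokenCode s' - tokenCode s ≠ 0 := by
      have : s' ≠ s := fun h => hs (by rw [h])
      simp only [tokenCode]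
      intro h
      apply this
      apply (Fintype.equivFin (Special B)).injective
      ext
      omega
    have := pow_pos (abs_pos.2 hne) 2
    rw [sq_abs] at this
    simp only [score]
    nlinarith

/-- The parabola `2 m j - j ^ 2` has its maximum at `j = m`, and all scores of special tokens are
negative. -/
theorem score_lt_number {N : ℕ} (k : Fin N) {s' : Tok B N} (hs : s' ≠ .num k) :
    score 0 (k + 1) s' < score 0 (k + 1) (.num k : Tok B N) := by
  cases s' with
  | num k' =>
    have hne : (k' : ℤ) - k ≠ 0 := by
      have : k' ≠ k := fun h => hs (by rw [h])
      rw [sub_ne_zero]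
      exact fun h => this (Fin.ext (by exact_mod_cast h))
    have := pow_pos (abs_pos.2 hne) 2
    rw [sq_abs] at this
    simp only [score]
    nlinarith
  | spec s' =>
    have h1 := (abs_tokenCode_le B s').1
    simp only [score]
    nlinarith

/-- The next token is the token whose code is at the head of the queue. -/
theorem next_network (hn : n ≤ T) (hS : S ≠ []) (hlen : S.length ≤ 100 * (T + 2))
    (hq : scale B T ^ 103 < 2 ^ q) (k : Fin (2 * T + 2)) (o : Option (Special B))
    (ho : pending M n S.reverse 0 = o.elim 0 tokenCode)
    (hk : o = none → cellLabel T (headPos S.reverse) = k + 1) :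
    (network M n T q).Next S (Tok.ofCode k o) := by
  intro s' hs'
  have hsum : 0 < ∑ s' : Tok B (2 * T + 2), Real.exp ((network M n T q).logit S s') :=
    Finset.sum_pos (fun s _ => Real.exp_pos _) ⟨s', Finset.mem_univ _⟩
  refine div_lt_div_of_pos_right (Real.exp_lt_exp.2 ?_) hsum
  rw [logit_network M S hn hS hlen hq, logit_network M S hn hS hlen hq, Int.cast_lt, ho]
  cases o with
  | none =>
    simp only [Option.elim_none, sub_zero, zero_le_one, max_eq_left, one_mul, hk rfl]
    exact score_lt_number k hs'
  | some s =>
    have h1 := (abs_tokenCode_le B s).1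
    rw [Option.elim_some, max_eq_right (by linarith), zero_mul]
    exact score_lt_special s hs'

end Output

end RagRNN

namespace RagRNN

/-! ### The queue of tokens -/

variable {B N : ℕ}

theorem codeAt_cons_zero (o : Option (Special B)) (w : List (Option (Special B))) :
    codeAt (o :: w) 0 = o.elim 0 tokenCode := rfl

theorem codeAt_cons_succ (o : Option (Special B)) (w : List (Option (Special B))) (i : ℕ) :
    codeAt (o :: w) (i + 1) = codeAt w i := by
  simp [codeAt]

theorem codeAt_append (v w : List (Option (Special B))) (i : ℕ) :
    codeAt (v ++ w) i = if i < v.length then codeAt v i else codeAt w (i - v.length) := by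
  split_ifs with h
  · simp [codeAt, List.getElem?_append_left h]
  · simp [codeAt, List.getElem?_append_right (not_lt.1 h)]

/-- After the sequence `S`, the tokens with the codes in `w` are to be generated. -/
def Queued (M : TM B) (n : ℕ) (S : List (Tok B N)) (w : List (Option (Special B))) : Prop :=
  ∀ i, pending M n S.reverse i = codeAt w i

/-- Tokens are put into the queue only after the result of a query and at the end of the input. -/
theorem injection_eq_zero {M : TM B} {n : ℕ} {s : Tok B N} {l : List (Tok B N)}
    (hend : seenAt endCode l 0 = 0) (hl : l.length ≠ n) (i : ℕ) :
    injection M n (s :: l) i = 0 := by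
  have ht : tableEntry M (s :: l) i = 0 := by
    refine Finset.sum_eq_zero fun j _ => ?_
    rw [seenAt_cons_succ _ _ _ 0, hend, max_eq_right (by split_ifs <;> norm_num), zero_mul]
  have hl' : ¬ (((s :: l).length : ℤ) = n + 1) := by
    rw [List.length_cons]; push_cast; omega
  rw [injection, ht, seenAt_cons_succ _ _ _ 0, hend, if_neg hl']
  simp

theorem Queued.append {M : TM B} {n : ℕ} {S : List (Tok B N)} {o : Option (Special B)}
    {w : List (Option (Special B))} (h : Queued M n S (o :: w))
    (hend : seenAt endCode S.reverse 0 = 0) (hS : S.length ≠ n) (s : Tok B N) :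
    Queued M n (S ++ [s]) w := by
  intro i
  rw [List.reverse_append, List.reverse_singleton, List.singleton_append, pending,
    injection_eq_zero hend (by simpa using hS), h, codeAt_cons_succ, add_zero]

theorem seenAt_reverse_append_singleton (g : Special B → ℤ) (S : List (Tok B N)) (s : Tok B N) :
    seenAt g (S ++ [s]).reverse 0 = s.extend g := by
  simp [seenAt]

theorem headPos_reverse_append (S S' : List (Tok B N)) :
    headPos (S ++ S').reverse = headPos S.reverse + headPos S'.reverse := by
  simp [headPos, List.sum_reverse, add_comm]

section Generation

variable {M : TM B} {n T q : ℕ}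

/-- Generation of one token other than an answer or the end of a query. -/
theorem solves_of_queued_cons (hn : n ≤ T) (hq : scale B T ^ 103 < 2 ^ q)
    {S : List (Tok B (2 * T + 2))} (hS : S ≠ [])
    (hlen : S.length ≤ 100 * (T + 2)) {k : Fin (2 * T + 2)} {o : Option (Special B)}
    {w : List (Option (Special B))} (h : Queued M n S (o :: w))
    (hk : o = none → cellLabel T (headPos S.reverse) = k + 1)
    (hy : o ≠ some (.ctl .yes)) (hno : o ≠ some (.ctl .no)) (he : o ≠ some (.ctl .endSearch))
    {b : Bool} {j : ℕ} (hsolves : (network M n T q).Solves (S ++ [Tok.ofCode k o]) b j) :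
    (network M n T q).Solves S b (j + 1) := by
  refine .step (next_network M S hn hS hlen hq k o ((h 0).trans (codeAt_cons_zero _ _)) hk)
    ?_ ?_ ?_ hsolves
  · cases o <;> simp_all [Tok.ofCode, LinearRNN.answer]
  · cases o <;> simp_all [Tok.ofCode, LinearRNN.answer]
  · rw [LinearRNN.extend, if_neg]
    cases o <;> simp_all [Tok.ofCode]

/-- Generation of several tokens that do not move the head. -/
theorem solves_of_queued_append (hn : n ≤ T) (hq : scale B T ^ 103 < 2 ^ q)
    (k : Fin (2 * T + 2)) (v w : List (Option (Special B)))
    (hv : ∀ s, some s ∈ v → moveCode s = 0 ∧ s ≠ .ctl .yes ∧ s ≠ .ctl .no ∧ s ≠ .ctl .endSearch)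
    {S : List (Tok B (2 * T + 2))} (hnS : n < S.length)
    (hlen : S.length + v.length ≤ 100 * (T + 2)) (h : Queued M n S (v ++ w))
    (hend : seenAt endCode S.reverse 0 = 0)
    (hk : none ∈ v → cellLabel T (headPos S.reverse) = k + 1) :
    Queued M n (S ++ v.map (Tok.ofCode k)) w ∧
    seenAt endCode (S ++ v.map (Tok.ofCode k)).reverse 0 = 0 ∧
    headPos (S ++ v.map (Tok.ofCode k)).reverse = headPos S.reverse ∧
    ∀ {b : Bool} {j : ℕ}, (network M n T q).Solves (S ++ v.map (Tok.ofCode k)) b j →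
      (network M n T q).Solves S b (j + v.length) := by
  induction v generalizing S with
  | nil => simpa using ⟨h, hend⟩
  | cons o v ih =>
    have hS : S ≠ [] := by rintro rfl; simp at hnS
    have hmove : headPos (S ++ [Tok.ofCode k o]).reverse = headPos S.reverse := by
      rw [headPos_reverse_append]
      cases o with
      | none => simp [headPos, Tok.ofCode, Tok.extend]
      | some s => simp [headPos, Tok.ofCode, Tok.extend, (hv s (by simp)).1]
    have hend' : seenAt endCode (S ++ [Tok.ofCode k o]).reverse 0 = 0 := by
      rw [seenAt_reverse_append_singleton]
      cases o with
      | none => rfl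
      | some s => simp [Tok.ofCode, Tok.extend, endCode, (hv s (by simp)).2.2.2]
    simp only [List.length_cons] at hlen
    obtain ⟨i1, i2, i3, i4⟩ := ih
      (S := S ++ [Tok.ofCode k o]) (fun s hs => hv s (by simp [hs])) (by simp; omega)
      (by simp; omega)
      (h.append hend (by omega) _) hend'
      (fun hnone => by rw [hmove]; exact hk (by simp [hnone]))
    simp only [List.append_assoc, List.singleton_append] at i1 i2 i3 i4
    refine ⟨i1, i2, i3.trans hmove, fun hsolves => ?_⟩
    rw [List.length_cons, ← add_assoc]
    refine solves_of_queued_cons hn hq hS (by omega) (k := k) h (fun ho => hk (by simp [ho]))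
      ?_ ?_ ?_ (i4 hsolves)
    · rintro rfl; exact (hv _ (by simp)).2.1 rfl
    · rintro rfl; exact (hv _ (by simp)).2.2.1 rfl
    · rintro rfl; exact (hv _ (by simp)).2.2.2 rfl

/-- A query: the state `s` and the search for the scanned cell are generated, and the result of
the search makes the network prepare the tokens of the next step of the machine. -/
theorem solves_of_search (hn : n ≤ T) (hq : scale B T ^ 103 < 2 ^ q)
    {S U : List (Tok B (2 * T + 2))} {s : Fin B} {c : Option (Fin B)}
    (k : Fin (2 * T + 2)) (h : Queued M n S (some (.sym s) :: searchCode)) (hnS : n < S.length)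
    (hlen : S.length + 33 ≤ 100 * (T + 2)) (hend : seenAt endCode S.reverse 0 = 0)
    (hk : cellLabel T (headPos S.reverse) = k + 1)
    (hret : retrieve (S ++ .spec (.sym s) :: .spec (.ctl .startSearch) ::
      queryCode.map (Tok.ofCode k)) = some [.spec (readSpecial c)])
    (hU : U = S ++ .spec (.sym s) :: .spec (.ctl .startSearch) :: queryCode.map (Tok.ofCode k) ++
      [.spec (.ctl .endSearch), .spec (readSpecial c)]) :
    Queued M n U (stepCode M s c ++ searchCode) ∧ seenAt endCode U.reverse 0 = 0 ∧
    headPos U.reverse = headPos S.reverse ∧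
    ∀ {b : Bool} {j : ℕ}, (network M n T q).Solves U b j →
      (network M n T q).Solves S b (j + 32) := by
  have hv : ∀ s', some s' ∈ some (.sym s) :: some (.ctl .startSearch) :: queryCode →
      moveCode s' = 0 ∧ s' ≠ .ctl .yes ∧ s' ≠ .ctl .no ∧ s' ≠ .ctl .endSearch := by
    intro s' hs'
    simp only [queryCode, List.mem_cons, Option.some.injEq, List.not_mem_nil, or_false] at hs'
    rcases hs' with rfl | hs'
    · simp [moveCode]
    · rcases hs' with rfl | rfl | rfl | rfl | rfl | rfl | rfl | rfl | hs' | rfl | rfl | rfl |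
        rfl | rfl | rfl | rfl | rfl | rfl | rfl | rfl | rfl | rfl | rfl | hs' | rfl | rfl | rfl |
        rfl | rfl | rfl <;> first | (exact absurd hs' (by simp)) | simp [moveCode]
  have hlength : (some (.sym s) :: some (.ctl .startSearch) :: queryCode :
      List (Option (Special B))).length = 31 := rfl
  obtain ⟨g1, g2, g3, g4⟩ := solves_of_queued_append (w := [some (.ctl .endSearch)]) hn hq k _ hv
    hnS (by rw [hlength]; omega) (by simpa [searchCode] using h) hend (fun _ => hk)
  rw [hlength] at g4
  set S' := S ++ (some (.sym s) :: some (.ctl .startSearch) :: queryCode).map (Tok.ofCode k)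
    with hS'
  have hS'len : S'.length = S.length + 31 := by simp [hS', queryCode]
  have hU' : U = S' ++ [.spec (.ctl .endSearch)] ++ [.spec (readSpecial c)] := by
    rw [hU, hS']; simp [Tok.ofCode]
  have hrev : U.reverse = .spec (readSpecial c) :: .spec (.ctl .endSearch) :: S'.reverse := by
    rw [hU']; simp
  have hstate : seenAt stateCode U.reverse 32 = s + 1 := by
    rw [hrev, hS']
    simp [seenAt, queryCode, Tok.ofCode, Tok.extend, stateCode]
  have hcontent : (readSpecial c).content = c := by cases c <;> rfl
  have hmove : moveCode (readSpecial c) = 0 := by cases c <;> rfl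
  refine ⟨fun i => ?_, ?_, ?_, fun hsolves => ?_⟩
  · have htable : tableEntry M U.reverse i = codeAt (stepCode M s c) i := by
      rw [tableEntry, hstate, Finset.sum_eq_single s]
      · simp [hrev, seenAt, Tok.extend, endCode, hcontent]
      · intro j _ hj
        rw [if_neg, hrev]
        · simp [seenAt, Tok.extend, endCode]
        · intro h
          exact hj (Fin.ext (by omega))
      · simp
    have hp : pending M n (.spec (.ctl .endSearch) :: S'.reverse) (i + 1) = 0 := by
      rw [pending, injection_eq_zero g2 (by simp; omega), g1]
      simp [codeAt]
    have hin : injection M n U.reverse i = codeAt (stepCode M s c ++ searchCode) i := by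
      have hl : ¬ ((U.reverse.length : ℤ) = n + 1) := by
        rw [hU']
        simp only [List.length_reverse, List.length_append, List.length_singleton]
        omega
      have hen : seenAt endCode U.reverse 1 = 1 := by
        rw [hrev]; simp [seenAt, Tok.extend, endCode]
      rw [injection, htable, hen, if_neg hl, tailCode, codeAt_append, codeAt_append]
      simp only [List.length_replicate, show (stepCode M s c).length = 5 from rfl]
      split_ifs with hi
      · have : codeAt (List.replicate 5 (none : Option (Special B))) i = 0 := by
          rw [codeAt, List.getElem?_replicate, if_pos hi]
          rfl
        rw [this]; ring
      · ring
    rw [← hin]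
    rw [hrev, pending, hp, zero_add]
  · rw [hU', seenAt_reverse_append_singleton]
    cases c <;> rfl
  · rw [hU', headPos_reverse_append, headPos_reverse_append, g3]
    have hmove' : moveCode (.ctl .endSearch : Special B) = 0 := rfl
    simp [headPos, Tok.extend, hmove, hmove']
  · refine g4 (.step (S' := U) (s := .spec (.ctl .endSearch)) ?_ ?_ ?_ ?_ hsolves)
    · exact next_network M S' hn (by rw [← List.length_pos_iff]; omega) (by omega) hq k
        (some (.ctl .endSearch)) ((g1 0).trans (codeAt_cons_zero _ _)) (by simp)
    · simp [LinearRNN.answer]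
    · simp [LinearRNN.answer]
    · rw [LinearRNN.extend, if_pos rfl, hU']
      have : retrieve S' = some [.spec (readSpecial c)] := by
        rw [← hret, hS']; simp [Tok.ofCode]
      rw [this]
      rfl

end Generation

end RagRNN

namespace RagRNN

/-! ### The simulation of a Turing machine -/

variable {B : ℕ}

theorem TM.run_succ (M : TM B) (x : List (Fin B)) (j : ℕ) :
    M.run x (j + 1) = M.step (M.run x j) := by
  rw [TM.run, Function.iterate_succ_apply', ← TM.run]

/-- The head has moved at most `j` cells in `j` steps. -/
theorem TM.abs_head_sub_one_le (M : TM B) (x : List (Fin B)) (j : ℕ) :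
    |(M.run x j).head - 1| ≤ j := by
  induction j with
  | zero => simp [TM.run, TM.init]
  | succ j ih =>
    rw [TM.run_succ, TM.step]
    rw [abs_le] at ih ⊢
    push_cast
    obtain ⟨h1, h2⟩ := ih
    split_ifs
    · constructor <;> linarith
    · constructor <;> linarith
    · constructor <;> dsimp only <;> linarith

theorem TM.haltedAt_of_le (M : TM B) {x : List (Fin B)} {s t : ℕ} (h : M.HaltedAt x s)
    (hst : s ≤ t) : M.run x t = M.run x s := by
  induction t, hst using Nat.le_induction with
  | base => rfl
  | succ t _ ih =>
    have h' : M.halting (M.run x s).state = true := h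
    rw [TM.run_succ, ih, TM.step, if_pos h']

theorem cellLabel_bounds {T : ℕ} {p : ℤ} (hp : |p - 1| ≤ T) :
    1 ≤ cellLabel T p ∧ cellLabel T p ≤ 2 * T + 2 := by
  rw [abs_le] at hp
  rcases le_or_gt p 0 with h | h
  · rw [cellLabel_of_nonpos T h]; omega
  · rw [cellLabel_of_pos T h]; omega

theorem cellLabel_injOn {T : ℕ} {p p' : ℤ} (hp : |p - 1| ≤ T) (hp' : |p' - 1| ≤ T)
    (h : cellLabel T p = cellLabel T p') : p = p' := by
  rw [abs_le] at hp hp'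
  rcases le_or_gt p 0 with h1 | h1 <;> rcases le_or_gt p' 0 with h2 | h2
  · rw [cellLabel_of_nonpos T h1, cellLabel_of_nonpos T h2] at h; omega
  · rw [cellLabel_of_nonpos T h1, cellLabel_of_pos T h2] at h; omega
  · rw [cellLabel_of_pos T h1, cellLabel_of_nonpos T h2] at h; omega
  · rw [cellLabel_of_pos T h1, cellLabel_of_pos T h2] at h; omega

/-- The state of the simulation before the state of the `j`-th configuration is generated: `S` is
the sequence of tokens and `L` the list of the steps that it records. What a query for a cell would
find in it is the content of that cell. -/
structure Simulates (M : TM B) (n T : ℕ) (x : List (Fin B)) (j : ℕ)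
    (S : List (Tok B (2 * T + 2))) (L : List (Record B (2 * T + 2))) : Prop where
  tokens : S ++ [.spec (.sym (M.run x j).state)] = history x M.start L
  length : S.length = n + 2 + 37 * j
  head : headPos S.reverse = (M.run x j).head
  notEnd : seenAt endCode S.reverse 0 = 0
  queued : Queued M n S (some (.sym (M.run x j).state) :: searchCode)
  tape : ∀ (k : Fin (2 * T + 2)) (p : ℤ), |p - 1| ≤ T → cellLabel T p = k + 1 →
    (lastWrite k L).or x[(k : ℕ)]? = (M.run x j).tape p

section Simulation

variable {M : TM B} {n T q : ℕ} {x : List (Fin B)}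

/-- No token is prepared before the end of the input. -/
theorem pending_eq_zero (l : List (Tok B (2 * T + 2))) (hl : l.length ≤ n)
    (hend : ∀ s ∈ l, s.extend endCode = 0) (i : ℕ) : pending M n l i = 0 := by
  induction l generalizing i with
  | nil => rfl
  | cons s l ih =>
    simp only [List.length_cons] at hl
    rw [pending, ih (by omega) (fun s hs => hend s (by simp [hs])),
      injection_eq_zero _ (by omega), add_zero]
    cases l with
    | nil => rfl
    | cons s' l => exact hend s' (by simp)

/-- The beginning: after the input, a move to the right leads from cell `0` to cell `1`. -/
theorem simulates_zero (hn : n ≤ T) (hq : scale B T ^ 103 < 2 ^ q)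
    (hx : x.length = n) (hT : n + 1 ≤ 100 * (T + 2)) :
    Simulates M n T x 0 (inputSeq x ++ [.spec (moveSpecial true)]) [] ∧
    ∀ {b : Bool} {i : ℕ}, (network M n T q).Solves (inputSeq x ++ [.spec (moveSpecial true)]) b i →
      (network M n T q).Solves (inputSeq x) b (i + 1) := by
  have hlen : (inputSeq x : List (Tok B (2 * T + 2))).length = n + 1 := by simp [inputSeq, hx]
  have hall : ∀ s ∈ (inputSeq x : List (Tok B (2 * T + 2))),
      s.extend endCode = 0 ∧ s.extend moveCode = 0 := by
    intro s hs
    simp only [inputSeq, List.mem_cons, List.mem_map] at hs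
    rcases hs with rfl | ⟨a, -, rfl⟩ <;> exact ⟨rfl, rfl⟩
  have hne : (inputSeq x : List (Tok B (2 * T + 2))).reverse ≠ [] := by simp [inputSeq]
  obtain ⟨s, l, hsl⟩ := List.exists_cons_of_ne_nil hne
  have hmem : ∀ s' ∈ s :: l, s'.extend endCode = 0 := fun s' hs' =>
    (hall s' (by rw [← List.mem_reverse, hsl]; exact hs')).1
  have hl : l.length = n := by
    have := congrArg List.length hsl
    rw [List.length_reverse, hlen, List.length_cons] at this
    omega
  have hend : seenAt endCode (inputSeq x : List (Tok B (2 * T + 2))).reverse 0 = 0 := by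
    rw [hsl]; exact hmem s (by simp)
  have hend' : seenAt endCode l 0 = 0 := by
    cases l with
    | nil => rfl
    | cons s' l => exact hmem s' (by simp)
  have hq0 : Queued M n (inputSeq x : List (Tok B (2 * T + 2))) (startCode M) := by
    intro i
    have ht : tableEntry M (s :: l) i = 0 := by
      refine Finset.sum_eq_zero fun j _ => ?_
      rw [seenAt_cons_succ _ _ _ 0, hend', max_eq_right (by split_ifs <;> norm_num), zero_mul]
    have hl' : (((s :: l).length : ℕ) : ℤ) = n + 1 := by
      rw [List.length_cons, hl]
      push_cast
      rfl
    rw [hsl, pending, pending_eq_zero l hl.le (fun s hs => hmem s (by simp [hs])), injection, ht,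
      seenAt_cons_succ _ _ _ 0, hend', if_pos hl']
    simp
  have hhead : headPos (inputSeq x : List (Tok B (2 * T + 2))).reverse = 0 := by
    rw [headPos, List.map_reverse, List.sum_reverse]
    refine List.sum_eq_zero fun v hv => ?_
    obtain ⟨s, hs, rfl⟩ := List.mem_map.1 hv
    exact (hall s hs).2
  refine ⟨⟨?_, ?_, ?_, ?_, ?_, ?_⟩, fun hsolves => ?_⟩
  · simp [history, TM.run, TM.init]
  · simp [hlen]
  · rw [headPos_reverse_append, hhead]; rfl
  · rw [seenAt_reverse_append_singleton]; rfl
  · exact hq0.append hend (by omega) _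
  · intro k p hp hk
    rw [abs_le] at hp
    rw [lastWrite, Option.none_or]
    simp only [TM.run, Function.iterate_zero, id, TM.init]
    rcases le_or_gt p 0 with h | h
    · rw [cellLabel_of_nonpos T h] at hk
      rw [if_neg (by omega), List.getElem?_eq_none (by omega)]
    · rw [cellLabel_of_pos T h] at hk
      rw [if_pos (by omega), show (p - 1).toNat = k by omega]
  · have hk : (0 : ℕ) < 2 * T + 2 := by omega
    exact solves_of_queued_cons hn hq (by simp [inputSeq]) (by omega) (k := ⟨0, hk⟩) hq0
      (by simp) (by simp [moveSpecial]) (by simp [moveSpecial]) (by simp [moveSpecial]) hsolves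

/-- The search for the scanned cell in the `j`-th configuration. -/
theorem Simulates.search (hn : n ≤ T) (hq : scale B T ^ 103 < 2 ^ q) {j : ℕ}
    {S : List (Tok B (2 * T + 2))} {L : List (Record B (2 * T + 2))}
    (h : Simulates M n T x j S L) (hj : j ≤ T) :
    ∃ (k : Fin (2 * T + 2)) (U : List (Tok B (2 * T + 2))),
      cellLabel T (M.run x j).head = k + 1 ∧
      U = history x M.start L ++ .spec (.ctl .startSearch) ::
        queryCode.map (Tok.ofCode k) ++
        [.spec (.ctl .endSearch), .spec (readSpecial ((M.run x j).tape (M.run x j).head))] ∧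
      U.length = S.length + 33 ∧ U.length ≤ 100 * (T + 2) - 40 ∧
      Queued M n U (stepCode M (M.run x j).state ((M.run x j).tape (M.run x j).head) ++
        searchCode) ∧
      seenAt endCode U.reverse 0 = 0 ∧ headPos U.reverse = (M.run x j).head ∧
      ∀ {b : Bool} {i : ℕ}, (network M n T q).Solves U b i →
        (network M n T q).Solves S b (i + 32) := by
  have hp : |(M.run x j).head - 1| ≤ T :=
    (M.abs_head_sub_one_le x j).trans (by exact_mod_cast hj)
  obtain ⟨hk1, hk2⟩ := cellLabel_bounds hp
  obtain ⟨k, hk⟩ : ∃ k : Fin (2 * T + 2), cellLabel T (M.run x j).head = k + 1 :=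
    ⟨⟨(cellLabel T (M.run x j).head - 1).toNat, by omega⟩, by simp only; omega⟩
  have hret := retrieve_history x M.start L k
  rw [h.tape k _ hp hk, ← h.tokens] at hret
  have hlen := h.length
  obtain ⟨u1, u2, u3, u4⟩ := solves_of_search hn hq k h.queued (by omega) (by omega) h.notEnd
    (by rw [h.head, hk]) (by simpa using hret) rfl
  refine ⟨k, _, hk, ?_, ?_, ?_, u1, u2, u3.trans h.head, u4⟩
  · rw [← h.tokens]; simp
  · simp [queryCode]
  · simp [queryCode]; omega

/-- One step of the machine costs 32 tokens for the query and 4 for the record up to the move; the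
new state is the first token of the next round. -/
theorem Simulates.step (hn : n ≤ T) (hq : scale B T ^ 103 < 2 ^ q) {j : ℕ}
    {S : List (Tok B (2 * T + 2))} {L : List (Record B (2 * T + 2))}
    (h : Simulates M n T x j S L) (hj : j ≤ T) (hhalt : ¬ M.HaltedAt x j) :
    ∃ (S' : List (Tok B (2 * T + 2))) (L' : List (Record B (2 * T + 2))),
      Simulates M n T x (j + 1) S' L' ∧
      ∀ {b : Bool} {i : ℕ}, (network M n T q).Solves S' b i →
        (network M n T q).Solves S b (i + 36) := by
  obtain ⟨k, U, hk, hU, hUlen, hUb, u1, u2, u3, u4⟩ := h.search hn hq hj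
  have hp : |(M.run x j).head - 1| ≤ T :=
    (M.abs_head_sub_one_le x j).trans (by exact_mod_cast hj)
  have hlen := h.length
  set c := M.run x j with hc
  set r := M.trans c.state (c.tape c.head) with hr
  have hhalt' : ¬ M.halting (M.run x j).state = true := hhalt
  have hnext : M.run x (j + 1) = ⟨r.1, if r.2.2 = true then c.head + 1 else c.head - 1,
      Function.update c.tape c.head (some r.2.1)⟩ := by
    rw [TM.run_succ, TM.step, if_neg hhalt']
  have hcode : stepCode M c.state (c.tape c.head) ++ searchCode =
      [some (.ctl .edge), none, some (.sym r.2.1)] ++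
        (some (moveSpecial r.2.2) :: some (.sym r.1) :: searchCode) := by
    simp [stepCode, show ¬ M.halting c.state = true from hhalt', ← hr]
  rw [hcode] at u1
  obtain ⟨v1, v2, v3, v4⟩ := solves_of_queued_append hn hq k
    [some (.ctl .edge), none, some (.sym r.2.1)] _
    (by
      intro s hs
      simp only [List.mem_cons, Option.some.injEq, List.not_mem_nil, or_false] at hs
      rcases hs with rfl | hs | rfl
      · simp [moveCode]
      · exact absurd hs (by simp)
      · simp [moveCode])
    (by omega) (by simp; omega) u1 u2 (fun _ => by rw [u3, hk])
  set V := U ++ [some (.ctl .edge), none, some (.sym r.2.1)].map (Tok.ofCode k) with hV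
  have hVlen : V.length = U.length + 3 := by simp [hV]
  have hmove : headPos (V ++ [(.spec (moveSpecial r.2.2) : Tok B (2 * T + 2))]).reverse =
      (M.run x (j + 1)).head := by
    rw [headPos_reverse_append, v3, u3, hnext]
    cases r.2.2 <;> rfl
  refine ⟨V ++ [.spec (moveSpecial r.2.2)], L ++ [⟨k, c.tape c.head, r.2.1, r.2.2, r.1⟩],
    ⟨?_, ?_, hmove, ?_, ?_, ?_⟩, fun hsolves => ?_⟩
  · have hh : history x M.start (L ++ [⟨k, c.tape c.head, r.2.1, r.2.2, r.1⟩]) =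
        history x M.start L ++ Record.toks ⟨k, c.tape c.head, r.2.1, r.2.2, r.1⟩ := by
      simp [history]
    rw [hh, hV, hU, hnext]
    simp [Record.toks, Tok.ofCode]
  · rw [List.length_append, List.length_singleton]
    omega
  · rw [seenAt_reverse_append_singleton]
    cases r.2.2 <;> rfl
  · rw [hnext]
    exact v1.append v2 (by omega) _
  · intro k' p hp' hk'
    rw [lastWrite_append, hnext]
    by_cases hpc : p = c.head
    · subst hpc
      have hkk : k = k' := Fin.ext (by omega)
      simp [hkk]
    · have hkk : ¬ k = k' := by
        rintro rfl
        exact hpc (cellLabel_injOn hp' hp (hk'.trans hk.symm))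
      rw [if_neg hkk, h.tape k' p hp' hk']
      exact (Function.update_of_ne hpc _ _).symm
  · have hV0 : V ≠ [] := by rw [← List.length_pos_iff]; omega
    have := solves_of_queued_cons hn hq hV0 (by omega) (k := k) v1 (by simp)
      (by simp [moveSpecial]) (by simp [moveSpecial]) (by simp [moveSpecial]) hsolves
    exact u4 (v4 this)

/-- When the machine has halted, the token after the result of the query is the answer. -/
theorem Simulates.halt (hn : n ≤ T) (hq : scale B T ^ 103 < 2 ^ q) {j : ℕ}
    {S : List (Tok B (2 * T + 2))} {L : List (Record B (2 * T + 2))}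
    (h : Simulates M n T x j S L) (hj : j ≤ T) (hhalt : M.HaltedAt x j) :
    (network M n T q).Solves S
      (M.verdict (M.run x j).state ((M.run x j).tape (M.run x j).head)) 32 := by
  obtain ⟨k, U, hk, hU, hUlen, hUb, u1, u2, u3, u4⟩ := h.search hn hq hj
  refine u4 (i := 0) (.done ?_)
  have hhalt' : M.halting (M.run x j).state = true := hhalt
  exact next_network M U hn (by rw [← List.length_pos_iff]; omega) (by omega) hq k
    (some (.ctl (if M.verdict (M.run x j).state ((M.run x j).tape (M.run x j).head) = true
      then .yes else .no)))
    ((u1 0).trans (by rw [stepCode, if_pos hhalt', List.cons_append, codeAt_cons_zero])) (by simp)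

/-- The network gives the result of the machine, with 36 tokens for every step. -/
theorem solves_inputSeq (hn : n ≤ T) (hq : scale B T ^ 103 < 2 ^ q)
    (hx : x.length = n) {t : ℕ} (ht : t ≤ T) (hhalt : M.HaltedAt x t)
    (hmin : ∀ j < t, ¬ M.HaltedAt x j) :
    (network M n T q).Solves (inputSeq x)
      (M.verdict (M.run x t).state ((M.run x t).tape (M.run x t).head)) (36 * t + 33) := by
  have key : ∀ d j S L, j + d = t → Simulates M n T x j S L → (network M n T q).Solves S
      (M.verdict (M.run x t).state ((M.run x t).tape (M.run x t).head)) (36 * d + 32) := by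
    intro d
    induction d with
    | zero =>
      intro j S L hj h
      obtain rfl : j = t := by omega
      simpa using h.halt hn hq ht hhalt
    | succ d ih =>
      intro j S L hj h
      obtain ⟨S', L', h', hs⟩ := h.step hn hq (by omega) (hmin j (by omega))
      have := hs (ih (j + 1) S' L' (by omega) h')
      rwa [show 36 * (d + 1) + 32 = 36 * d + 32 + 36 by ring]
  obtain ⟨h0, hs⟩ := simulates_zero (M := M) hn hq hx (by omega)
  exact hs (key t 0 _ _ (by omega) h0)

end Simulation

end RagRNN

namespace RagRNN

/-! ### The size of the network -/

section Size

/-- The state has at most as many coordinates as there are indices of nonzero rows. -/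
theorem IntBlock.stateDim_toBlock_le {ι α : Type} [Fintype ι] [Fintype α]
    {F : IntBlock ι} (f : α → ι) (h : ∀ i, (∀ a, f a ≠ i) → F.luA i = 0 ∧ F.luB i = 0) (w : ℕ) :
    (F.toBlock w).stateDim ≤ Fintype.card α := by
  classical
  rw [Block.stateDim, ← Finset.card_univ]
  refine (Finset.card_le_card fun i hi => ?_).trans
    (Finset.card_image_le (s := Finset.univ) (f := f))
  by_contra hi'
  obtain ⟨h1, h2⟩ := h i fun a ha => hi' (Finset.mem_image.2 ⟨a, Finset.mem_univ _, ha⟩)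
  simp [toBlock, h1, h2] at hi

variable {B : ℕ}

theorem stateDim_block₁ (n T w : ℕ) : ((block₁ B n T).toBlock w).stateDim ≤ 36 := by
  let f : Fin 33 ⊕ Fin 2 ⊕ Unit → Coord B (extraDim B) :=
    Sum.elim (fun i => wk (.delay i)) (Sum.elim (fun i => wk (.ended i)) fun _ => wk .head)
  refine IntBlock.stateDim_toBlock_le f (fun i hi => ?_) w
  induction i using coord_cases with
  | h4 v =>
    cases v with
    | delay i => exact absurd rfl (hi (.inl i))
    | ended i => exact absurd rfl (hi (.inr (.inl i)))
    | head => exact absurd rfl (hi (.inr (.inr ())))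
    | _ => simp [block₁]
  | _ => simp [block₁, workVec]

theorem stateDim_block₂ (M : TM B) (w : ℕ) : ((block₂ M).toBlock w).stateDim ≤ 0 :=
  IntBlock.stateDim_toBlock_le (α := Empty) (fun a => a.elim) (fun _ _ => ⟨rfl, rfl⟩) w

theorem stateDim_block₃ (M : TM B) (w : ℕ) : ((block₃ M).toBlock w).stateDim ≤ 36 := by
  refine IntBlock.stateDim_toBlock_le (fun i : Fin 36 => wk (.chain i)) (fun i hi => ?_) w
  induction i using coord_cases with
  | h4 v =>
    cases v with
    | chain i => exact absurd rfl (hi i)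
    | _ => simp [block₃]
  | _ => simp [block₃, workVec]

theorem memory_network_le (M : TM B) (n T q : ℕ) :
    (network M n T q).memory ≤ 72 * (network M n T q).precision := by
  refine Nat.mul_le_mul_right _ ?_
  have h1 := stateDim_block₁ (B := B) n T (ffnWidth B)
  have h2 := stateDim_block₂ M (ffnWidth B)
  have h3 := stateDim_block₃ M (ffnWidth B)
  simp only [List.map_cons, List.map_nil, List.sum_cons, List.sum_nil]
  omega

/-- The dimension is at most `108 * B` and the width at most `33 * B`. -/
theorem numParams_network_le (M : TM B) (n T q : ℕ) :
    (network M n T q).numParams ≤ 102582 * B ^ 2 := by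
  have hB : 1 ≤ B := M.start.pos
  have hd : Fintype.card (Coord B (extraDim B)) ≤ 108 * B := by
    have := card_coord_le B
    omega
  have hw : ffnWidth B ≤ 33 * B := by
    simp only [ffnWidth]
    omega
  have hB2 : B ≤ B ^ 2 := Nat.le_self_pow two_ne_zero B
  calc (network M n T q).numParams
      ≤ 3 * (2 * (108 * B) ^ 2 + 3 * ((33 * B) * (108 * B)) + 2 * (33 * B) + 108 * B) := by
        simp only [LinearRNN.numParams, LinearRNN.dim, List.length_cons, List.length_nil]
        gcongr
    _ ≤ 102582 * B ^ 2 := by nlinarith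

theorem inPrecision_network (M : TM B) {n T q : ℕ} (hn : n ≤ T) (hq : scale B T < 2 ^ q) :
    (network M n T q).InPrecision := by
  have h0 : 0 ≤ scale B T := by rw [scale]; positivity
  intro F hF
  simp only [List.mem_cons, List.not_mem_nil, or_false] at hF
  rcases hF with rfl | rfl | rfl
  · exact (weightsLE_block₁ T hn).inPrecision h0 hq _
  · exact (weightsLE_block₂ T M).inPrecision h0 hq _
  · exact (weightsLE_block₃ T M).inPrecision h0 hq _

/-- The number of bits before the binary point that suffices for all numbers that occur. -/
def bits (B T : ℕ) : ℕ := 104 * Nat.clog 2 ((B + 200) ^ 2 * (T + 2))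

theorem two_le_sq_mul (B : ℕ) {m : ℕ} (hm : 0 < m) : 2 ≤ (B + 200) ^ 2 * m :=
  calc 2 ≤ B + 200 := by omega
    _ ≤ (B + 200) ^ 2 := Nat.le_self_pow two_ne_zero _
    _ ≤ (B + 200) ^ 2 * m := Nat.le_mul_of_pos_right _ hm

theorem scale_pow_lt (B T : ℕ) : scale B T ^ 103 < 2 ^ bits B T := by
  have h1 : 1 < (B + 200) ^ 2 * (T + 2) := two_le_sq_mul B (by omega)
  have h2 : ((B + 200) ^ 2 * (T + 2)) ^ 103 < 2 ^ bits B T := by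
    calc ((B + 200) ^ 2 * (T + 2)) ^ 103 < ((B + 200) ^ 2 * (T + 2)) ^ 104 :=
          Nat.pow_lt_pow_right h1 (by norm_num)
      _ ≤ (2 ^ Nat.clog 2 ((B + 200) ^ 2 * (T + 2))) ^ 104 :=
          Nat.pow_le_pow_left (Nat.le_pow_clog one_lt_two _) _
      _ = 2 ^ bits B T := by rw [bits, ← pow_mul, mul_comm]
  rw [scale]
  exact_mod_cast h2

theorem scale_lt (B T : ℕ) : scale B T < 2 ^ bits B T := by
  have h : 1 ≤ scale B T := by
    have := (scale_ge B T).2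
    omega
  exact (le_self_pow₀ h (by norm_num)).trans_lt (scale_pow_lt B T)

/-- For large `n`, the precision is logarithmic in `n`: constant factors disappear in `n ^ A`. -/
theorem bits_le {B K n T : ℕ} {A : ℝ} (hA : 1 ≤ A) (hK : 1 ≤ K)
    (hT : (T : ℝ) ≤ K * (n : ℝ) ^ A) (hn : (B + 200) ^ 2 * (3 * K) ≤ n) :
    (bits B T : ℝ) ≤ 312 * A * Real.logb 2 n := by
  have hn2 : 2 ≤ n := le_trans (two_le_sq_mul B (by omega)) hn
  have hn1 : (1 : ℝ) ≤ n := by exact_mod_cast (by omega : 1 ≤ n)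
  have hpow : (1 : ℝ) ≤ (n : ℝ) ^ A := Real.one_le_rpow hn1 (by linarith)
  have hK' : (1 : ℝ) ≤ K := by exact_mod_cast hK
  have hlog : 1 ≤ Real.logb 2 n := by
    rw [Real.le_logb_iff_rpow_le one_lt_two (by linarith), Real.rpow_one]
    exact_mod_cast hn2
  set Z := (B + 200) ^ 2 * (T + 2) with hZ
  have hZ0 : 0 < Z := by positivity
  have hZle : (Z : ℝ) ≤ (n : ℝ) ^ (1 + A) := by
    calc (Z : ℝ) = ((B : ℝ) + 200) ^ 2 * (T + 2) := by rw [hZ]; push_cast; rfl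
      _ ≤ ((B : ℝ) + 200) ^ 2 * (3 * K * (n : ℝ) ^ A) := by
        refine mul_le_mul_of_nonneg_left ?_ (by positivity)
        have := one_le_mul_of_one_le_of_one_le hK' hpow
        rw [mul_assoc]
        linarith
      _ = ((B + 200) ^ 2 * (3 * K) : ℕ) * (n : ℝ) ^ A := by push_cast; ring
      _ ≤ n * (n : ℝ) ^ A := by
        refine mul_le_mul_of_nonneg_right ?_ (by positivity)
        exact_mod_cast hn
      _ = (n : ℝ) ^ (1 + A) := by rw [Real.rpow_add (by linarith), Real.rpow_one]
  have hclog : (Nat.clog 2 Z : ℝ) ≤ (1 + A) * Real.logb 2 n + 1 := by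
    have h1 : (Nat.clog 2 Z : ℝ) < Real.logb 2 Z + 1 := by
      rw [← Real.natCeil_logb_natCast]
      refine Nat.ceil_lt_add_one (Real.logb_nonneg one_lt_two ?_)
      exact_mod_cast hZ0
    have h2 : Real.logb 2 Z ≤ (1 + A) * Real.logb 2 n := by
      rw [← Real.logb_rpow_eq_mul_logb_of_pos (by linarith)]
      exact Real.logb_le_logb_of_le one_lt_two (by exact_mod_cast hZ0) hZle
    linarith
  have hA1 : 1 ≤ A * Real.logb 2 n := one_le_mul_of_one_le_of_one_le hA hlog
  have hA2 : Real.logb 2 n ≤ A * Real.logb 2 n := le_mul_of_one_le_left (by linarith) hA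
  rw [bits, Nat.cast_mul, Nat.cast_ofNat]
  linarith

end Size

end RagRNN

theorem mainTheorem3 :
    ∃ c : ℕ, ∀ (A : ℝ) (B K : ℕ) (M : RagRNN.TM B), 1 ≤ A → 1 ≤ K → M.RunsInTime A K →
      ∃ (R : ℕ → RagRNN.LinearRNN B) (n₀ : ℕ), ∀ n : ℕ, 1 ≤ n →
        (R n).InPrecision ∧
        (n₀ ≤ n →
          ((R n).precision : ℝ) ≤ c * A * Real.logb 2 n ∧
          ((R n).memory : ℝ) ≤ c * A * Real.logb 2 n) ∧
        ((R n).numParams : ℝ) ≤ c * A * (B : ℝ) ^ 2 ∧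
        ((R n).N : ℝ) ≤ c * K * (n : ℝ) ^ A ∧
        ∀ (x : List (Fin B)) (b : Bool), x.length = n → M.Result x b →
          ∃ k : ℕ, (k : ℝ) ≤ c * K * (n : ℝ) ^ A ∧
            (R n).Solves (RagRNN.inputSeq x) b k := by
  open RagRNN in
  classical
  -- The constant bounds the number of parameters divided by `B ^ 2`. It exceeds the other constants:
  -- 625 for the precision, 72 * 625 for the memory, 4 for `N` and 69 for the number of steps.
  refine ⟨102582, fun A B K M hA hK hM => ?_⟩
  let T : ℕ → ℕ := fun n => ⌊(K : ℝ) * (n : ℝ) ^ A⌋₊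
  refine ⟨fun n => network M n (T n) (bits B (T n)), (B + 200) ^ 2 * (3 * K), fun n hn => ?_⟩
  have hn1 : (1 : ℝ) ≤ n := by exact_mod_cast hn
  have hK1 : (1 : ℝ) ≤ K := by exact_mod_cast hK
  have hnA : (n : ℝ) ≤ (n : ℝ) ^ A := Real.self_le_rpow_of_one_le hn1 hA
  have hKnA : (n : ℝ) ≤ K * (n : ℝ) ^ A := hnA.trans (le_mul_of_one_le_left (by linarith) hK1)
  have hT : (T n : ℝ) ≤ K * (n : ℝ) ^ A := Nat.floor_le (by linarith)
  have hnT : n ≤ T n := Nat.le_floor hKnA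
  refine ⟨inPrecision_network M hnT (scale_lt B (T n)), fun hn₀ => ?_, ?_, ?_, ?_⟩
  · have hbits := bits_le hA hK hT hn₀
    have hlog : 1 ≤ A * Real.logb 2 n := by
      refine one_le_mul_of_one_le_of_one_le hA ?_
      rw [Real.le_logb_iff_rpow_le one_lt_two (by linarith), Real.rpow_one]
      exact_mod_cast le_trans (two_le_sq_mul B (by omega)) hn₀
    have hp : ((network M n (T n) (bits B (T n))).precision : ℝ) ≤ 625 * (A * Real.logb 2 n) := by
      rw [LinearRNN.precision]
      push_cast
      linarith
    have hm : ((network M n (T n) (bits B (T n))).memory : ℝ) ≤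
        72 * (network M n (T n) (bits B (T n))).precision := by
      exact_mod_cast memory_network_le M n (T n) (bits B (T n))
    constructor
    · push_cast
      linarith
    · push_cast
      linarith
  · have h : ((network M n (T n) (bits B (T n))).numParams : ℝ) ≤ 102582 * (B : ℝ) ^ 2 := by
      exact_mod_cast numParams_network_le M n (T n) (bits B (T n))
    refine h.trans ?_
    push_cast
    exact mul_le_mul_of_nonneg_right (by linarith) (by positivity)
  · push_cast
    linarith
  · rintro x b hx ⟨t', ht', hb⟩
    have hex : ∃ t, M.HaltedAt x t := ⟨t', ht'⟩
    have hx0 : x ≠ [] := by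
      rintro rfl
      simp at hx
      omega
    obtain ⟨s, hs, hsh⟩ := hM x hx0
    rw [hx] at hs
    -- The simulation is run until the machine halts for the first time.
    have htT : Nat.find hex ≤ T n := (Nat.find_min' hex hsh).trans (Nat.le_floor hs)
    have hrun := M.haltedAt_of_le (Nat.find_spec hex) (Nat.find_min' hex ht')
    refine ⟨36 * Nat.find hex + 33, ?_, ?_⟩
    · have h : (Nat.find hex : ℝ) ≤ K * (n : ℝ) ^ A := le_trans (by exact_mod_cast htT) hT
      push_cast
      linarith
    · rw [← hb, hrun]
      exact solves_inputSeq hnT (scale_pow_lt B (T n)) hx htT (Nat.find_spec hex)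
        fun j hj => Nat.find_min hex hj
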